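/- A \emph{square} is a topological disk with four privileged boundary points, its vertices. A \emph{quadriculated disk} $\Delta$ is a closed topological disk formed by the juxtaposition along sides of finitely many squares such that every interior vertex belongs to precisely four squares. Its squares can be colored black and white so that squares with a common side have opposite colors. Fix any such coloring, and label the black squares by $1,\dots,b$ and the white squares by $1,\dots,w$; the \emph{black-to-white matrix} $B_\Delta$ is the $b\times w$ matrix whose $(i,j)$ entry is $1$ if the $i$-th black and the $j$-th white square share a side, and $0$ otherwise. A rectangular matrix $\tilde D$ is a \emph{defective identity} if every entry equals $0$ or $1$ and if $\tilde d_{ij}=\tilde d_{i'j'}=1$ implies either $i=i'$, $j=j'$, or $i<i'$, $j<j'$, or $i>i'$, $j>j'$. \textbf{Theorem.} Let $\Delta$ be a quadriculated disk with at least two squares, and fix a coloring as above (one exists). For an appropriate labeling of the black squares and of the white squares, $B_\Delta = L\tilde D U$, where $L$ is a $b\times b$ invertible lower triangular matrix, $U$ is a $w\times w$ invertible upper triangular matrix, $\tilde D$ is a $b\times w$ defective identity, and all entries of $L$, $\tilde D$ and $U$ are equal to $0$, $1$ or $-1$. -/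

import Mathlib

open scoped unitInterval

/-- The model square is `I × I` with corners `0 = (0,0)`, `1 = (1,0)`, `2 = (1,1)`, `3 = (0,1)`,
listed counterclockwise.  `sidePoint k t` is the point at time `t` of side `k`, which is traversed
counterclockwise from corner `k` to corner `k + 1` (indices modulo `4`). -/
def sidePoint : Fin 4 → I → I × I
  | 0, t => (t, 0)
  | 1, t => (1, t)
  | 2, t => (unitInterval.symm t, 1)
  | 3, t => (0, unitInterval.symm t)

/-- Instructions for juxtaposing the squares of a family indexed by `S` along sides.
The pair `(s, k)` is side `k` of the square `s`.  The sides `d` and `mate d` are identified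
if they are different; if `mate d = d`, then the side `d` is not identified with any side. -/
structure SquareGluing (S : Type*) where
  mate : S × Fin 4 → S × Fin 4
  mate_mate : ∀ d, mate (mate d) = d

namespace SquareGluing

variable {S : Type*} (G : SquareGluing S)

/-- Identification of the points of two different mated sides.  Squares are oriented
counterclockwise, so the two sides are traversed in opposite directions. -/
inductive PointRel : (Σ _ : S, I × I) → (Σ _ : S, I × I) → Prop
  | glue (d : S × Fin 4) (hd : G.mate d ≠ d) (t : I) :
      PointRel ⟨d.1, sidePoint d.2 t⟩
        ⟨(G.mate d).1, sidePoint (G.mate d).2 (unitInterval.symm t)⟩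

/-- The topological space formed by the squares: the disjoint union of the squares with mated
sides identified, with the quotient topology. -/
abbrev Realization : Type _ := Quot G.PointRel

/-- The identification of corners that results from the gluing of sides; `(s, k)` is corner `k`
of the square `s`.  The starting point of a side is glued to the end point of its mate
(the other end point is covered by the same rule for the mate). -/
inductive CornerRel : S × Fin 4 → S × Fin 4 → Prop
  | glue (d : S × Fin 4) (hd : G.mate d ≠ d) :
      CornerRel d ((G.mate d).1, (G.mate d).2 + 1)

/-- The vertices: classes of corners under the equivalence relation generated by `CornerRel`. -/
abbrev Vertex : Type _ := Quot G.CornerRel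

/-- The vertex at corner `k` of the square `s`. -/
def vertex (s : S) (k : Fin 4) : G.Vertex := Quot.mk _ (s, k)

/-- A vertex is interior if it is not an end point of a boundary side,
that is, of a side that is not glued to another one. -/
def IsInterior (v : G.Vertex) : Prop :=
  ∀ (s : S) (k : Fin 4), G.mate (s, k) = (s, k) → v ≠ G.vertex s k ∧ v ≠ G.vertex s (k + 1)

/-- The set of squares to which a vertex belongs. -/
def squaresAt (v : G.Vertex) : Set S := {s | ∃ k, G.vertex s k = v}

/-- Two different squares share a side. -/
def Adj (s t : S) : Prop := s ≠ t ∧ ∃ k l, G.mate (s, k) = (t, l)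

/-- A coloring of the squares (`true` is black, `false` is white) in which squares with a
common side have opposite colors. -/
def IsBicoloring (c : S → Bool) : Prop := ∀ s t, G.Adj s t → c s ≠ c t

open Classical in
/-- The black-to-white matrix for given labelings of the black and of the white squares. -/
noncomputable def blackToWhite {c : S → Bool} {b w : ℕ}
    (β : Fin b ≃ {s // c s = true}) (ω : Fin w ≃ {s // c s = false}) :
    Matrix (Fin b) (Fin w) ℤ :=
  Matrix.of fun i j => if G.Adj (β i) (ω j) then 1 else 0

end SquareGluing

/-- A quadriculated disk with set of squares `S`: a closed topological disk formed by the
juxtaposition along sides of squares, each with four distinct vertices, such that every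
interior vertex belongs to precisely four squares. -/
structure QuadriculatedDisk (S : Type*) extends SquareGluing S where
  isDisk : Nonempty
    (toSquareGluing.Realization ≃ₜ Metric.closedBall (0 : EuclideanSpace ℝ (Fin 2)) 1)
  vertex_injective : ∀ s, Function.Injective (toSquareGluing.vertex s)
  interior_four : ∀ v, toSquareGluing.IsInterior v → (toSquareGluing.squaresAt v).ncard = 4

/-- A defective identity: a rectangular matrix with entries `0` and `1` in which the positions
of any two entries equal to `1` coincide or are strictly ordered in both coordinates. -/
def IsDefectiveIdentity {n m : ℕ} (D : Matrix (Fin n) (Fin m) ℤ) : Prop :=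
  (∀ i j, D i j = 0 ∨ D i j = 1) ∧
  ∀ i j i' j', D i j = 1 → D i' j' = 1 →
    (i = i' ∧ j = j') ∨ (i < i' ∧ j < j') ∨ (i' < i ∧ j' < j)

/-- Every entry equals `0`, `1` or `-1`. -/
def HasUnitEntries {n m : ℕ} (A : Matrix (Fin n) (Fin m) ℤ) : Prop :=
  ∀ i j, A i j = 0 ∨ A i j = 1 ∨ A i j = -1

/-! The disk enters through the vanishing of its first cohomology. Since each interior vertex has
four squares, the obstruction to rotating all squares so that their directions agree is a closed
cochain with values in `Fin 4`, hence exact. The squares then have partial neighbors to the east and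
north, and every cochain on pairs of neighbors that is closed on 2×2 blocks is exact. The induction
keeps only this last property, `IsExactGrid`. It requires neither connectedness nor an embedding in
the plane, and therefore survives the cutting and gluing below.

The induction is on the number of squares. Exactness makes the Euler characteristic positive, so for
each of the four quadrants there are more convex corners than reflex ones
(`card_reflex_lt_card_convex`). After reversing all directions if necessary, there are more convex
south-western corners than reflex north-eastern ones. From each convex south-western corner follow
the diagonal of squares to the north-east as long as blocks continue it. Different starts have
different ends, so some diagonal `s 0, …, s m` ends at a square without eastern or without northern
neighbor (`exists_good_diagonal`).

Let `t i` and `u i` be the northern and eastern neighbors of `s i`. Gaussian elimination of the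
columns `s 0, …, s (m - 1)` with pivot rows `t 0, …, t (m - 1)` merely subtracts row `t i` from row
`u i`. Up to signs of rows and columns, what remains is the adjacency matrix of the grid in which
these `s i` are removed, `t i` is glued to `u i`, and `s m` is cut from its western and southern
neighbors (`exists_sign`). This zipped grid is again exact (`isExactGrid_zip`), so the induction
continues. For `m = 0` a leaf is removed with its neighbor, or an isolated square gives a zero row
or column, which is the source of the defects of `D`. Every pivot is `1`, and its row and column
have entries `0`, `1`, `-1`; these become the entries of `L` and `U`. -/

/-! ### Locally constant cocycles on contractible spaces -/

/-- On a contractible space, a locally constant cocycle with values in an abelian group, defined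
on an open cover, is a coboundary. -/
theorem exists_primitive_of_locally_constant_cocycle {X ι A : Type*} [TopologicalSpace X]
    [ContractibleSpace X] [AddCommGroup A] (U : ι → Set X) (hU : ∀ i, IsOpen (U i))
    (hcov : ∀ x, ∃ i, x ∈ U i) (T : ι → ι → X → A)
    (hT : ∀ i j, ∀ x ∈ U i ∩ U j, ∀ᶠ y in nhds x, T i j y = T i j x)
    (hcomp : ∀ i j k x, x ∈ U i → x ∈ U j → x ∈ U k → T i j x + T j k x = T i k x) :
    ∃ φ : ι → X → A, (∀ i, ∀ x ∈ U i, ∀ᶠ y in nhds x, φ i y = φ i x) ∧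
      ∀ i j x, x ∈ U i → x ∈ U j → φ j x = φ i x + T i j x := by
  classical
  let : TopologicalSpace A := ⊥
  have : DiscreteTopology A := ⟨rfl⟩
  choose idx hidx using hcov
  -- Glue the products `U i × A` by the translations `T i j`. As `A` is discrete, the projection is
  -- a covering.
  let Z : FiberBundleCore ι X A :=
    { baseSet := U
      isOpen_baseSet := hU
      indexAt := idx
      mem_baseSet_at := hidx
      coordChange := fun i j x a => a + T i j x
      coordChange_self := by
        intro i x hx v
        have := hcomp i i i x hx hx hx
        simp only [add_eq_left] at this ⊢
        exact this
      continuousOn_coordChange := by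
        intro i j
        refine continuous_snd.continuousOn.add (fun p hp => ?_)
        refine ContinuousAt.continuousWithinAt ?_
        have h1 : ContinuousAt (T i j) p.1 :=
          (continuousAt_const (y := T i j p.1)).congr
            ((hT i j p.1 hp.1).mono fun y hy => hy.symm)
        exact ContinuousAt.comp (f := Prod.fst) (g := T i j) h1 continuousAt_fst
      coordChange_comp := by
        intro i j k x hx v
        rw [add_assoc, hcomp i j k x hx.1.1 hx.1.2 hx.2] }
  have hc : IsCoveringMap Z.proj := FiberBundle.isCoveringMap (F := A) (E := Z.Fiber)
  obtain ⟨x₀, ⟨H⟩⟩ := id_nullhomotopic X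
  -- The reversed contraction runs from a constant map to the identity, so its lift starting at the
  -- constant `e₀` ends with a global section. The coordinates of this section in the
  -- trivializations are the primitive.
  let H' := H.symm
  let e₀ : Z.TotalSpace := ⟨x₀, (0 : A)⟩
  have H0 : ∀ a, H'.toContinuousMap (0, a) = Z.proj (ContinuousMap.const X e₀ a) := by
    intro a
    exact H'.apply_zero a
  let sec : X → Z.TotalSpace := fun x => hc.liftHomotopy H'.toContinuousMap (.const X e₀) H0 (1, x)
  have hsec : Continuous sec :=
    (hc.liftHomotopy H'.toContinuousMap (.const X e₀) H0).continuous.comp (by fun_prop)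
  have hsec_proj : ∀ x, Z.proj (sec x) = x := by
    intro x
    have := congrFun (hc.liftHomotopy_lifts H'.toContinuousMap (.const X e₀) H0) (1, x)
    exact this.trans (H'.apply_one x)
  refine ⟨fun i x => (Z.localTriv i (sec x)).2, ?_, ?_⟩
  · intro i x hx
    have h1 : ContinuousAt (fun x => (Z.localTriv i (sec x)).2) x := by
      have h2 : ContinuousAt (Z.localTriv i) (sec x) := by
        refine (Z.localTriv i).continuousOn_toFun.continuousAt
          ((Z.localTriv i).open_source.mem_nhds ?_)
        rw [(Z.localTriv i).source_eq]
        change Z.proj (sec x) ∈ U i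
        rwa [hsec_proj]
      exact continuous_snd.continuousAt.comp (h2.comp hsec.continuousAt)
    have := h1.eventually (f := fun x => (Z.localTriv i (sec x)).2)
      (p := fun a => a = (Z.localTriv i (sec x)).2) (by simp [nhds_discrete])
    exact this
  · intro i j x hi hj
    let a : A := (sec x).2
    have e1 : ∀ k, (Z.localTriv k (sec x)).2 = a + T (idx x) k x := by
      intro k
      change a + T (idx (Z.proj (sec x))) k (Z.proj (sec x)) = _
      rw [hsec_proj]
    change (Z.localTriv j (sec x)).2 = (Z.localTriv i (sec x)).2 + T i j x
    rw [e1, e1, add_assoc, hcomp (idx x) i j x (hidx x) hi hj]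

/-! ### Factorizations and single elimination steps -/

/-- The matrix `M`, restricted to the rows in `P` and the columns in `Q`, factors as `L * D * U` for
some ordering of the rows and of the columns, with entries `0`, `1`, `-1`, where `L` and `U` are
invertible and triangular and `D` is a defective identity. -/
def FactorsOn {S : Type*} (M : S → S → ℤ) (P Q : Finset S) : Prop :=
  ∃ (b w : ℕ) (β : Fin b → S) (ω : Fin w → S) (L : Matrix (Fin b) (Fin b) ℤ)
    (D : Matrix (Fin b) (Fin w) ℤ) (U : Matrix (Fin w) (Fin w) ℤ),
    Function.Injective β ∧ Set.range β = P ∧ Function.Injective ω ∧ Set.range ω = Q ∧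
    Matrix.of (fun i j => M (β i) (ω j)) = L * D * U ∧
    L.IsLowerTriangular ∧ IsUnit L ∧ U.IsUpperTriangular ∧ IsUnit U ∧
    IsDefectiveIdentity D ∧ HasUnitEntries L ∧ HasUnitEntries U

theorem IsDefectiveIdentity.hasUnitEntries {n m : ℕ} {D : Matrix (Fin n) (Fin m) ℤ}
    (hD : IsDefectiveIdentity D) : HasUnitEntries D := fun i j =>
  (hD.1 i j).imp_right Or.inl

namespace FactorsOn

variable {S : Type*} {M M' : S → S → ℤ} {P Q : Finset S}

theorem congr (h : FactorsOn M P Q) (hM : ∀ x ∈ P, ∀ y ∈ Q, M' x y = M x y) :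
    FactorsOn M' P Q := by
  obtain ⟨b, w, β, ω, L, D, U, hβ, hP, hω, hQ, hLDU, h⟩ := h
  refine ⟨b, w, β, ω, L, D, U, hβ, hP, hω, hQ, ?_, h⟩
  rw [← hLDU]
  ext i j
  have h1 : β i ∈ (P : Set S) := hP ▸ Set.mem_range_self i
  have h2 : ω j ∈ (Q : Set S) := hQ ▸ Set.mem_range_self j
  exact hM _ h1 _ h2

theorem empty : FactorsOn M ∅ ∅ := by
  refine ⟨0, 0, Fin.elim0, Fin.elim0, 1, 0, 1, fun i => i.elim0, by simp, fun i => i.elim0,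
    by simp, ?_, fun i => i.elim0, isUnit_one, fun i => i.elim0, isUnit_one,
    ⟨fun i => i.elim0, fun i => i.elim0⟩, fun i => i.elim0, fun i => i.elim0⟩
  ext i
  exact i.elim0

/-- Exchanges the two colors, so that later arguments may assume that a diagonal starts at a column.
-/
theorem transpose (h : FactorsOn M P Q) : FactorsOn (fun x y => M y x) Q P := by
  obtain ⟨b, w, β, ω, L, D, U, hβ, hP, hω, hQ, hLDU, hL, hL', hU, hU', hD, hLe, hUe⟩ := h
  refine ⟨w, b, ω, β, U.transpose, D.transpose, L.transpose, hω, hQ, hβ, hP, ?_, ?_, ?_, ?_, ?_,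
    ⟨fun i j => hD.1 j i, fun i j i' j' h1 h2 => ?_⟩, fun i j => hUe j i, fun i j => hLe j i⟩
  · rw [Matrix.mul_assoc, ← Matrix.transpose_mul, ← Matrix.transpose_mul, ← hLDU]
    rfl
  · exact fun i j hij => hU hij
  · rwa [Matrix.isUnit_transpose]
  · exact fun i j hij => hL hij
  · rwa [Matrix.isUnit_transpose]
  · have := hD.2 j i j' i' h1 h2
    tauto

/-- Multiplication of rows and columns by signs. -/
theorem scale (h : FactorsOn M P Q) (ε : S → ℤ) (hε : ∀ x, ε x = 1 ∨ ε x = -1) :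
    FactorsOn (fun x y => ε x * M x y * ε y) P Q := by
  have hε2 : ∀ x, ε x * ε x = 1 := fun x => by rcases hε x with h | h <;> simp [h]
  obtain ⟨b, w, β, ω, L, D, U, hβ, hP, hω, hQ, hLDU, hL, hL', hU, hU', hD, hLe, hUe⟩ := h
  have hdiag : ∀ {n : ℕ} (f : Fin n → S), IsUnit (Matrix.diagonal fun i => ε (f i)) := by
    intro n f
    refine IsUnit.of_mul_eq_one (Matrix.diagonal fun i => ε (f i)) ?_
    rw [Matrix.diagonal_mul_diagonal]
    simp [hε2]
  refine ⟨b, w, β, ω, Matrix.diagonal (fun i => ε (β i)) * L, D,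
    U * Matrix.diagonal (fun i => ε (ω i)), hβ, hP, hω, hQ, ?_, ?_, (hdiag β).mul hL', ?_,
    hU'.mul (hdiag ω), hD, ?_, ?_⟩
  · have : Matrix.diagonal (fun i => ε (β i)) * L * D * (U * Matrix.diagonal (fun i => ε (ω i)))
      = Matrix.diagonal (fun i => ε (β i)) * (L * D * U) * Matrix.diagonal (fun i => ε (ω i)) := by
      simp only [Matrix.mul_assoc]
    rw [this, ← hLDU]
    ext i j
    simp [Matrix.diagonal_mul, Matrix.mul_diagonal]
  · intro i j hij
    rw [Matrix.diagonal_mul, hL hij, mul_zero]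
  · intro i j hij
    rw [Matrix.mul_diagonal, hU hij, zero_mul]
  · intro i j
    rw [Matrix.diagonal_mul]
    rcases hε (β i) with h | h <;> rcases hLe i j with h' | h' | h' <;> simp [h, h']
  · intro i j
    rw [Matrix.mul_diagonal]
    rcases hε (ω j) with h | h <;> rcases hUe i j with h' | h' | h' <;> simp [h, h']

end FactorsOn

section Bordered

variable {n m : ℕ}

/-- The matrix `A` with a first row `a, r` and a first column `a, c`. -/
def bordered (a : ℤ) (r : Fin m → ℤ) (c : Fin n → ℤ) (A : Matrix (Fin n) (Fin m) ℤ) :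
    Matrix (Fin (n + 1)) (Fin (m + 1)) ℤ :=
  Matrix.of (Fin.cons (Fin.cons a r) fun i => Fin.cons (c i) (A i))

@[simp] theorem bordered_zero_zero (a : ℤ) (r : Fin m → ℤ) (c : Fin n → ℤ)
    (A : Matrix (Fin n) (Fin m) ℤ) : bordered a r c A 0 0 = a := rfl

@[simp] theorem bordered_zero_succ (a : ℤ) (r : Fin m → ℤ) (c : Fin n → ℤ)
    (A : Matrix (Fin n) (Fin m) ℤ) (j) : bordered a r c A 0 (Fin.succ j) = r j := rfl

@[simp] theorem bordered_succ_zero (a : ℤ) (r : Fin m → ℤ) (c : Fin n → ℤ)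
    (A : Matrix (Fin n) (Fin m) ℤ) (i) : bordered a r c A (Fin.succ i) 0 = c i := rfl

@[simp] theorem bordered_succ_succ (a : ℤ) (r : Fin m → ℤ) (c : Fin n → ℤ)
    (A : Matrix (Fin n) (Fin m) ℤ) (i j) :
    bordered a r c A (Fin.succ i) (Fin.succ j) = A i j := rfl

theorem IsDefectiveIdentity.bordered {D : Matrix (Fin n) (Fin m) ℤ} (hD : IsDefectiveIdentity D) :
    IsDefectiveIdentity (bordered 1 0 0 D) := by
  refine ⟨fun i j => ?_, fun i j i' j' => ?_⟩
  · cases i using Fin.cases <;> cases j using Fin.cases <;> simp [hD.1]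
  · cases i using Fin.cases <;> cases j using Fin.cases <;> cases i' using Fin.cases <;>
      cases j' using Fin.cases <;> simp
    exact hD.2 _ _ _ _

theorem HasUnitEntries.bordered {a : ℤ} {r : Fin m → ℤ} {c : Fin n → ℤ}
    {A : Matrix (Fin n) (Fin m) ℤ} (ha : a = 1) (hr : ∀ j, r j = 0 ∨ r j = 1 ∨ r j = -1)
    (hc : ∀ j, c j = 0 ∨ c j = 1 ∨ c j = -1) (hA : HasUnitEntries A) :
    HasUnitEntries (bordered a r c A) := by
  intro i j
  cases i using Fin.cases <;> cases j using Fin.cases <;> simp [ha, hr, hc, hA _ _]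

theorem isLowerTriangular_bordered {c : Fin n → ℤ} {L : Matrix (Fin n) (Fin n) ℤ}
    (hL : L.IsLowerTriangular) : (bordered 1 0 c L).IsLowerTriangular := by
  intro i j hij
  have hij' : i < j := hij
  cases i using Fin.cases <;> cases j using Fin.cases
  · simp at hij'
  · simp
  · simp at hij'
  · exact hL (Fin.succ_lt_succ_iff.mp hij')

theorem isUpperTriangular_bordered {r : Fin n → ℤ} {U : Matrix (Fin n) (Fin n) ℤ}
    (hU : U.IsUpperTriangular) : (bordered 1 r 0 U).IsUpperTriangular := by
  intro i j hij
  have hij' : j < i := hij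
  cases i using Fin.cases <;> cases j using Fin.cases
  · simp at hij'
  · simp at hij'
  · simp
  · exact hU (Fin.succ_lt_succ_iff.mp hij')

theorem isUnit_bordered_of_isLowerTriangular {c : Fin n → ℤ} {L : Matrix (Fin n) (Fin n) ℤ}
    (hL : L.IsLowerTriangular) (h : IsUnit L) : IsUnit (bordered 1 0 c L) := by
  rw [Matrix.isUnit_iff_isUnit_det, Matrix.det_of_isLowerTriangular _
    (isLowerTriangular_bordered hL), Fin.prod_univ_succ]
  rw [Matrix.isUnit_iff_isUnit_det, Matrix.det_of_isLowerTriangular _ hL] at h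
  simpa using h

theorem isUnit_bordered_of_isUpperTriangular {r : Fin n → ℤ} {U : Matrix (Fin n) (Fin n) ℤ}
    (hU : U.IsUpperTriangular) (h : IsUnit U) : IsUnit (bordered 1 r 0 U) := by
  rw [Matrix.isUnit_iff_isUnit_det, Matrix.det_of_isUpperTriangular
    (isUpperTriangular_bordered hU), Fin.prod_univ_succ]
  rw [Matrix.isUnit_iff_isUnit_det, Matrix.det_of_isUpperTriangular hU] at h
  simpa using h

end Bordered

namespace FactorsOn

variable {S : Type*} {M : S → S → ℤ} {P Q : Finset S}

theorem range_cons_eq [DecidableEq S] {n : ℕ} {β : Fin n → S} {r : S} (hr : r ∈ P)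
    (h : Set.range β = (P.erase r : Finset S)) :
    Set.range (Fin.cons r β : Fin (n + 1) → S) = P := by
  rw [Fin.range_cons, h, ← Finset.coe_insert, Finset.insert_erase hr]

theorem injective_cons [DecidableEq S] {n : ℕ} {β : Fin n → S} {r : S}
    (hβ : Function.Injective β) (h : Set.range β = (P.erase r : Finset S)) :
    Function.Injective (Fin.cons r β : Fin (n + 1) → S) := by
  rw [Fin.cons_injective_iff]
  refine ⟨?_, hβ⟩
  rw [h]
  simp

/-- Elimination with a pivot equal to `1`. -/
theorem pivot [DecidableEq S] {r c : S} (hr : r ∈ P) (hc : c ∈ Q) (hrc : M r c = 1)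
    (hcol : ∀ x ∈ P, M x c = 0 ∨ M x c = 1 ∨ M x c = -1)
    (hrow : ∀ y ∈ Q, M r y = 0 ∨ M r y = 1 ∨ M r y = -1)
    (h : FactorsOn (fun x y => M x y - M x c * M r y) (P.erase r) (Q.erase c)) :
    FactorsOn M P Q := by
  obtain ⟨b, w, β, ω, L, D, U, hβ, hP, hω, hQ, hLDU, hL, hL', hU, hU', hD, hLe, hUe⟩ := h
  have hβP : ∀ i, β i ∈ P := fun i => Finset.mem_of_mem_erase (s := P) (a := r)
    (by rw [← Finset.mem_coe, ← hP]; exact Set.mem_range_self i)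
  have hωQ : ∀ i, ω i ∈ Q := fun i => Finset.mem_of_mem_erase (s := Q) (a := c)
    (by rw [← Finset.mem_coe, ← hQ]; exact Set.mem_range_self i)
  -- In block form, `[1 ρ; γ A] = [1 0; γ L] * [1 0; 0 D] * [1 ρ; 0 U]` whenever the Schur
  -- complement `A - γ ρ` equals `L * D * U`.
  refine ⟨b + 1, w + 1, Fin.cons r β, Fin.cons c ω, bordered 1 0 (fun i => M (β i) c) L,
    bordered 1 0 0 D, bordered 1 (fun j => M r (ω j)) 0 U, injective_cons hβ hP,
    range_cons_eq hr hP, injective_cons hω hQ, range_cons_eq hc hQ, ?_,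
    isLowerTriangular_bordered hL, isUnit_bordered_of_isLowerTriangular hL hL',
    isUpperTriangular_bordered hU, isUnit_bordered_of_isUpperTriangular hU hU', hD.bordered,
    HasUnitEntries.bordered rfl (by simp) (fun j => hcol _ (hβP j)) hLe,
    HasUnitEntries.bordered rfl (fun j => hrow _ (hωQ j)) (by simp) hUe⟩
  ext i j
  cases i using Fin.cases with
  | zero =>
    cases j using Fin.cases <;>
      simp [Matrix.mul_apply, Fin.sum_univ_succ, hrc]
  | succ i =>
    cases j using Fin.cases with
    | zero => simp [Matrix.mul_apply, Fin.sum_univ_succ]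
    | succ j =>
      have := congrFun (congrFun hLDU i) j
      simp only [Matrix.of_apply] at this
      simp only [Matrix.of_apply, Fin.cons_succ, Matrix.mul_apply, Fin.sum_univ_succ,
        bordered_zero_zero, bordered_zero_succ, bordered_succ_zero, bordered_succ_succ] at this ⊢
      simp only [Pi.zero_apply, mul_zero, Finset.sum_const_zero, mul_one, add_zero, zero_add]
      linarith

/-- A vanishing row may be omitted. -/
theorem zero_row [DecidableEq S] {r : S} (hr : r ∈ P) (hrow : ∀ y ∈ Q, M r y = 0)
    (h : FactorsOn M (P.erase r) Q) : FactorsOn M P Q := by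
  obtain ⟨b, w, β, ω, L, D, U, hβ, hP, hω, hQ, hLDU, hL, hL', hU, hU', hD, hLe, hUe⟩ := h
  have hωQ : ∀ i, ω i ∈ Q := fun i => by
    rw [← Finset.mem_coe, ← hQ]; exact Set.mem_range_self i
  obtain ⟨D', hD0, hDs⟩ : ∃ D' : Matrix (Fin (b + 1)) (Fin w) ℤ,
      (∀ j, D' 0 j = 0) ∧ ∀ i j, D' (Fin.succ i) j = D i j :=
    ⟨Matrix.of (Fin.cons (fun _ => 0) D), fun _ => rfl, fun _ _ => rfl⟩
  -- The zero row goes in front of `D`, which shifts all ones down equally and keeps their order.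
  refine ⟨b + 1, w, Fin.cons r β, ω, bordered 1 0 0 L, D', U,
    injective_cons hβ hP, range_cons_eq hr hP, hω, hQ, ?_,
    isLowerTriangular_bordered hL, isUnit_bordered_of_isLowerTriangular hL hL', hU, hU', ?_,
    HasUnitEntries.bordered rfl (by simp) (by simp) hLe, hUe⟩
  · ext i j
    cases i using Fin.cases with
    | zero => simp [Matrix.mul_apply, Fin.sum_univ_succ, hrow _ (hωQ j), hD0]
    | succ i =>
      have := congrFun (congrFun hLDU i) j
      simp only [Matrix.of_apply] at this
      simp [this, Matrix.mul_apply, Fin.sum_univ_succ, hDs]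
  · refine ⟨fun i j => ?_, fun i j i' j' => ?_⟩
    · cases i using Fin.cases <;> simp [hD.1, hD0, hDs]
    · cases i using Fin.cases <;> cases i' using Fin.cases <;> simp [hD0, hDs]
      exact hD.2 _ _ _ _

theorem zero_col [DecidableEq S] {c : S} (hc : c ∈ Q) (hcol : ∀ x ∈ P, M x c = 0)
    (h : FactorsOn M P (Q.erase c)) : FactorsOn M P Q :=
  (h.transpose.zero_row hc hcol).transpose

end FactorsOn

/-! ### Exact grids and deletion of squares -/

/-- The squares `s`, `t`, `x`, `y` surround a vertex, to its south-west, south-east, north-east and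
north-west, respectively; `E s t` says that `t` is the eastern neighbor of `s`, and `N s t` that it
is the northern one. -/
def IsBlock {S : Type*} (E N : S → S → Prop) (s t x y : S) : Prop :=
  E s t ∧ N t x ∧ N s y ∧ E y x

/-- Squares with eastern and northern neighbors, such that every cochain on pairs of neighbors
that is closed on blocks is exact. -/
structure IsExactGrid {S : Type*} (E N : S → S → Prop) : Prop where
  east : Relator.BiUnique E
  north : Relator.BiUnique N
  exact : ∀ (A : Type) [AddCommGroup A] (f g : S → S → A),
    (∀ s t x y, IsBlock E N s t x y → f s t + g t x = g s y + f y x) →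
    ∃ h : S → A, (∀ s t, E s t → f s t = h t - h s) ∧ ∀ s t, N s t → g s t = h t - h s

namespace IsExactGrid

variable {S : Type*} {E N : S → S → Prop}

theorem swap (G : IsExactGrid E N) : IsExactGrid N E where
  east := G.north
  north := G.east
  exact A _ f g H := by
    obtain ⟨h, h1, h2⟩ := G.exact A g f fun s t x y hs => (H s y x t
      ⟨hs.2.2.1, hs.2.2.2, hs.1, hs.2.1⟩).symm
    exact ⟨h, h2, h1⟩

theorem flip_east (G : IsExactGrid E N) : IsExactGrid (flip E) N where
  east := ⟨fun _ _ _ h1 h2 => G.east.2 h1 h2, fun _ _ _ h1 h2 => G.east.1 h1 h2⟩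
  north := G.north
  exact A _ f g H := by
    obtain ⟨h, h1, h2⟩ := G.exact A (fun s t => - f t s) g fun s t x y hs => by
      have := H t s y x ⟨hs.1, hs.2.2.1, hs.2.1, hs.2.2.2⟩
      rw [eq_sub_of_add_eq this.symm]
      abel
    refine ⟨h, fun s t hst => ?_, h2⟩
    rw [← neg_sub, ← h1 t s hst, neg_neg]

theorem flip_north (G : IsExactGrid E N) : IsExactGrid E (flip N) :=
  G.swap.flip_east.swap

theorem flip_both (G : IsExactGrid E N) : IsExactGrid (flip E) (flip N) :=
  G.flip_east.flip_north

/-- Coordinates are primitives of the cochains that are `1` in one direction and `0` in the other.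
They serve to tell squares apart and to show that diagonals stop. -/
theorem exists_position (G : IsExactGrid E N) : ∃ X Y : S → ℤ,
    (∀ s t, E s t → X t = X s + 1 ∧ Y t = Y s) ∧ ∀ s t, N s t → X t = X s ∧ Y t = Y s + 1 := by
  obtain ⟨X, hX1, hX2⟩ := G.exact ℤ (fun _ _ => 1) (fun _ _ => 0) (by simp)
  obtain ⟨Y, hY1, hY2⟩ := G.exact ℤ (fun _ _ => 0) (fun _ _ => 1) (by simp)
  refine ⟨X, Y, fun s t h => ?_, fun s t h => ?_⟩
  · have := hX1 s t h
    have := hY1 s t h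
    constructor <;> linarith
  · have := hX2 s t h
    have := hY2 s t h
    constructor <;> linarith

/-- Deletion of a square without eastern neighbor. -/
theorem delete_of_not_east (G : IsExactGrid E N) {t : S} (ht : ∀ x, ¬ E t x) :
    IsExactGrid (fun a b => E a b ∧ a ≠ t ∧ b ≠ t) (fun a b => N a b ∧ a ≠ t ∧ b ≠ t) where
  east := ⟨fun _ _ _ h1 h2 => G.east.1 h1.1 h2.1, fun _ _ _ h1 h2 => G.east.2 h1.1 h2.1⟩
  north := ⟨fun _ _ _ h1 h2 => G.north.1 h1.1 h2.1, fun _ _ _ h1 h2 => G.north.2 h1.1 h2.1⟩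
  exact A _ f g H := by
    classical
    obtain ⟨X, Y, hX, hY⟩ := G.exists_position
    -- To extend the cochain over `t`, give the step from its western neighbor the value `0`.
    -- Without an eastern neighbor, `t` lies in at most two blocks; these force the values `cN` and
    -- `cS` of the steps to the north of `t` and from the south into `t`, independently of each
    -- other.
    have hcN : ∃ c : A, ∀ w y n, IsBlock E N w t n y → c = g w y + f y n := by
      by_cases h : ∃ w y n, IsBlock E N w t n y
      · obtain ⟨w, y, n, hb⟩ := h
        refine ⟨g w y + f y n, fun w' y' n' hb' => ?_⟩
        obtain rfl := G.east.1 hb.1 hb'.1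
        obtain rfl := G.north.2 hb.2.1 hb'.2.1
        obtain rfl := G.north.2 hb.2.2.1 hb'.2.2.1
        rfl
      · exact ⟨0, fun w y n hb => absurd ⟨w, y, n, hb⟩ h⟩
    have hcS : ∃ c : A, ∀ x q w, IsBlock E N x q t w → c = g x w - f x q := by
      by_cases h : ∃ x q w, IsBlock E N x q t w
      · obtain ⟨x, q, w, hb⟩ := h
        refine ⟨g x w - f x q, fun x' q' w' hb' => ?_⟩
        obtain rfl := G.east.1 hb.2.2.2 hb'.2.2.2
        obtain rfl := G.north.1 hb.2.1 hb'.2.1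
        obtain rfl := G.north.1 hb.2.2.1 hb'.2.2.1
        rfl
      · exact ⟨0, fun w y n hb => absurd ⟨w, y, n, hb⟩ h⟩
    obtain ⟨cN, hcN⟩ := hcN
    obtain ⟨cS, hcS⟩ := hcS
    obtain ⟨h, h1, h2⟩ := G.exact A (fun a b => if b = t then 0 else f a b)
      (fun a b => if a = t then cN else if b = t then cS else g a b) (by
        intro s q x y hb
        obtain ⟨b1, b2, b3, b4⟩ := id hb
        have p1 := hX _ _ b1
        have p2 := hY _ _ b2
        have p3 := hY _ _ b3
        have p4 := hX _ _ b4
        have hs : s ≠ t := by rintro rfl; exact ht _ b1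
        have hy : y ≠ t := by rintro rfl; exact ht _ b4
        by_cases hq : q = t
        · subst hq
          have hx : x ≠ q := by rintro rfl; omega
          simp only [if_true, if_neg hs, if_neg hy, if_neg hx, zero_add]
          exact hcN _ _ _ hb
        by_cases hx : x = t
        · subst hx
          simp only [if_true, if_neg hs, if_neg hy, if_neg hq, add_zero]
          rw [hcS _ _ _ hb, add_sub_cancel]
        · simp only [if_neg hs, if_neg hy, if_neg hx, if_neg hq]
          exact H s q x y ⟨⟨b1, hs, hq⟩, ⟨b2, hq, hx⟩, ⟨b3, hs, hy⟩, ⟨b4, hy, hx⟩⟩)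
    refine ⟨h, fun a b hab => ?_, fun a b hab => ?_⟩
    · rw [← h1 a b hab.1, if_neg hab.2.2]
    · rw [← h2 a b hab.1, if_neg hab.2.1, if_neg hab.2.2]

theorem congr (G : IsExactGrid E N) {E' N' : S → S → Prop} (hE : ∀ a b, E a b ↔ E' a b)
    (hN : ∀ a b, N a b ↔ N' a b) : IsExactGrid E' N' := by
  obtain rfl : E = E' := by ext a b; exact hE a b
  obtain rfl : N = N' := by ext a b; exact hN a b
  exact G

/-- Deletion of a square that lacks a neighbor on some side. -/
theorem delete (G : IsExactGrid E N) {t : S}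
    (ht : (∀ x, ¬ E t x) ∨ (∀ x, ¬ E x t) ∨ (∀ x, ¬ N t x) ∨ ∀ x, ¬ N x t) :
    IsExactGrid (fun a b => E a b ∧ a ≠ t ∧ b ≠ t) (fun a b => N a b ∧ a ≠ t ∧ b ≠ t) := by
  rcases ht with h | h | h | h
  · exact G.delete_of_not_east h
  · refine (G.flip_east.delete_of_not_east h).flip_east.congr ?_ ?_ <;>
      grind [flip]
  · exact (G.swap.delete_of_not_east h).swap
  · refine (G.flip_north.swap.delete_of_not_east h).swap.flip_north.congr ?_ ?_ <;>
      grind [flip]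

end IsExactGrid

/-! ### Counting corners and finding a diagonal -/

namespace IsExactGrid

variable {S : Type*} {E N : S → S → Prop}

open Classical in
/-- An Euler characteristic estimate: a nonempty exact grid has positive Euler characteristic. -/
theorem card_east_add_card_north_lt [Fintype S] (G : IsExactGrid E N) {V : Finset S}
    (hV : V.Nonempty) (hE : ∀ s t, E s t → s ∈ V ∧ t ∈ V) (hN : ∀ s t, N s t → s ∈ V ∧ t ∈ V) :
    Fintype.card {s // ∃ t, E s t} + Fintype.card {s // ∃ t, N s t} <
      V.card + Fintype.card {s // ∃ t x y, IsBlock E N s t x y} := by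
  -- Compare dimensions in the complex from squares to steps to blocks, over some field. Steps and
  -- blocks are indexed by their western, southern or south-western square, which determines them.
  -- Exactness is `hker`; strictness comes from the constants in the kernel of `d₀`.
  let K := ZMod 2
  have : Fact (Nat.Prime 2) := ⟨Nat.prime_two⟩
  let HE := {s // ∃ t, E s t}
  let HN := {s // ∃ t, N s t}
  let HB := {s // ∃ t x y, IsBlock E N s t x y}
  choose e he using fun s : HE => s.2
  choose n hn using fun s : HN => s.2
  choose t x y hb using fun s : HB => s.2
  let p₁ (s : HB) : HE := ⟨s.1, _, (hb s).1⟩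
  let p₂ (s : HB) : HN := ⟨t s, _, (hb s).2.1⟩
  let p₃ (s : HB) : HN := ⟨s.1, _, (hb s).2.2.1⟩
  let p₄ (s : HB) : HE := ⟨y s, _, (hb s).2.2.2⟩
  let d₁ : ((HE → K) × (HN → K)) →ₗ[K] (HB → K) :=
    { toFun := fun F s => F.1 (p₁ s) + F.2 (p₂ s) - F.2 (p₃ s) - F.1 (p₄ s)
      map_add' := by
        intro F F'
        ext s
        simp only [Prod.fst_add, Prod.snd_add, Pi.add_apply]
        ring
      map_smul' := by
        intro c F
        ext s
        simp only [Prod.smul_fst, Prod.smul_snd, Pi.smul_apply, smul_eq_mul, RingHom.id_apply]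
        ring }
  let d₀ : (V → K) →ₗ[K] ((HE → K) × (HN → K)) :=
    { toFun := fun h => (fun s => h ⟨e s, (hE _ _ (he s)).2⟩ - h ⟨s.1, (hE _ _ (he s)).1⟩,
        fun s => h ⟨n s, (hN _ _ (hn s)).2⟩ - h ⟨s.1, (hN _ _ (hn s)).1⟩)
      map_add' := by
        intro h h'
        ext s <;> simp only [Prod.fst_add, Prod.snd_add, Pi.add_apply] <;> ring
      map_smul' := by
        intro c h
        ext s <;> simp only [Prod.smul_fst, Prod.smul_snd, Pi.smul_apply, smul_eq_mul,
          RingHom.id_apply] <;> ring }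
  have hker : LinearMap.ker d₁ ≤ LinearMap.range d₀ := by
    rintro ⟨f, g⟩ hF
    rw [LinearMap.mem_ker] at hF
    obtain ⟨h, h1, h2⟩ := G.exact K (fun a _ => if ha : ∃ b, E a b then f ⟨a, ha⟩ else 0)
      (fun a _ => if ha : ∃ b, N a b then g ⟨a, ha⟩ else 0) (by
        intro s t' x' y' hb'
        have hs : ∃ t x y, IsBlock E N s t x y := ⟨_, _, _, hb'⟩
        have ht : t' = t ⟨s, hs⟩ := G.east.2 hb'.1 (hb ⟨s, hs⟩).1
        have hy : y' = y ⟨s, hs⟩ := G.north.2 hb'.2.2.1 (hb ⟨s, hs⟩).2.2.1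
        rw [dif_pos ⟨_, hb'.1⟩, dif_pos ⟨_, hb'.2.1⟩, dif_pos ⟨_, hb'.2.2.1⟩,
          dif_pos ⟨_, hb'.2.2.2⟩]
        have := congrFun hF ⟨s, hs⟩
        change f (p₁ ⟨s, hs⟩) + g (p₂ ⟨s, hs⟩) - g (p₃ ⟨s, hs⟩) - f (p₄ ⟨s, hs⟩) = 0 at this
        subst ht hy
        linear_combination this)
    refine ⟨fun v => h v.1, ?_⟩
    refine Prod.ext ?_ ?_
    · ext s
      have := h1 _ _ (he s)
      rw [dif_pos ⟨_, he s⟩] at this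
      exact this.symm
    · ext s
      have := h2 _ _ (hn s)
      rw [dif_pos ⟨_, hn s⟩] at this
      exact this.symm
  have hpos : 0 < Module.finrank K (LinearMap.ker d₀) := by
    rw [Module.finrank_pos_iff_exists_ne_zero]
    obtain ⟨v, hv⟩ := hV
    refine ⟨⟨fun _ => 1, ?_⟩, fun h0 => ?_⟩
    · rw [LinearMap.mem_ker]
      refine Prod.ext ?_ ?_ <;> ext s <;> exact sub_self _
    · have h1 := congrFun (congrArg Subtype.val h0) ⟨v, hv⟩
      exact one_ne_zero (α := K) h1
  have r₀ := LinearMap.finrank_range_add_finrank_ker d₀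
  have r₁ := LinearMap.finrank_range_add_finrank_ker d₁
  have hle := Submodule.finrank_mono hker
  have hle' := Submodule.finrank_le (LinearMap.range d₁)
  rw [Module.finrank_prod, Module.finrank_fintype_fun_eq_card,
    Module.finrank_fintype_fun_eq_card] at r₁
  rw [Module.finrank_fintype_fun_eq_card, Fintype.card_coe] at r₀
  rw [Module.finrank_fintype_fun_eq_card] at hle'
  change Fintype.card HE + Fintype.card HN < V.card + Fintype.card HB
  omega

theorem ncard_eq_card_filter (V : Finset S) (p : S → Prop) [DecidablePred p] :
    {s | s ∈ V ∧ p s}.ncard = (V.filter p).card := by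
  rw [← Set.ncard_coe_finset]
  congr 1
  ext s
  simp

/-- There are more convex corners than reflex corners, in any of the four orientations. -/
theorem card_reflex_lt_card_convex [Fintype S] (G : IsExactGrid E N) {V : Finset S}
    (hV : V.Nonempty) (hE : ∀ s t, E s t → s ∈ V ∧ t ∈ V) (hN : ∀ s t, N s t → s ∈ V ∧ t ∈ V) :
    {s | s ∈ V ∧ (∃ t, E s t) ∧ (∃ t, N s t) ∧ ¬ ∃ t x y, IsBlock E N s t x y}.ncard <
      {s | s ∈ V ∧ (∀ t, ¬ E s t) ∧ ∀ t, ¬ N s t}.ncard := by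
  classical
  rw [ncard_eq_card_filter, ncard_eq_card_filter]
  have key := G.card_east_add_card_north_lt hV hE hN
  have hcard : ∀ (p : S → Prop) [DecidablePred p] [Fintype {s // p s}], (∀ s, p s → s ∈ V) →
      Fintype.card {s // p s} = (V.filter p).card := by
    intro p _ _ hp
    rw [Fintype.card_subtype]
    congr 1
    ext s
    simp only [Finset.mem_filter, Finset.mem_univ, true_and]
    exact ⟨fun h => ⟨hp s h, h⟩, fun h => h.2⟩
  rw [hcard (fun s => ∃ t, E s t) fun s ⟨t, h⟩ => (hE s t h).1,
    hcard (fun s => ∃ t, N s t) fun s ⟨t, h⟩ => (hN s t h).1,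
    hcard (fun s => ∃ t x y, IsBlock E N s t x y) fun s ⟨t, x, y, h⟩ => (hE s t h.1).1] at key
  have h1 := Finset.card_union_add_card_inter (V.filter fun s => ∃ t, E s t)
    (V.filter fun s => ∃ t, N s t)
  have h2 : (V.filter fun s => ∃ t, E s t) ∩ (V.filter fun s => ∃ t, N s t) =
      (V.filter fun s => ∃ t x y, IsBlock E N s t x y) ∪
      (V.filter fun s => (∃ t, E s t) ∧ (∃ t, N s t) ∧ ¬ ∃ t x y, IsBlock E N s t x y) := by
    ext s
    simp only [Finset.mem_inter, Finset.mem_filter, Finset.mem_union]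
    constructor
    · rintro ⟨⟨h1, h2⟩, -, h3⟩
      by_cases h : ∃ t x y, IsBlock E N s t x y
      · exact Or.inl ⟨h1, h⟩
      · exact Or.inr ⟨h1, h2, h3, h⟩
    · rintro (⟨h, t, x, y, hb⟩ | ⟨h, h1, h2, -⟩)
      · exact ⟨⟨h, t, hb.1⟩, h, y, hb.2.2.1⟩
      · exact ⟨⟨h, h1⟩, h, h2⟩
  have h3 : Disjoint (V.filter fun s => ∃ t x y, IsBlock E N s t x y)
      (V.filter fun s => (∃ t, E s t) ∧ (∃ t, N s t) ∧ ¬ ∃ t x y, IsBlock E N s t x y) := by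
    rw [Finset.disjoint_filter]
    intro s _ h h'
    exact h'.2.2 h
  have h4 : (V.filter fun s => (∀ t, ¬ E s t) ∧ ∀ t, ¬ N s t) =
      V \ ((V.filter fun s => ∃ t, E s t) ∪ (V.filter fun s => ∃ t, N s t)) := by
    ext s
    simp only [Finset.mem_filter, Finset.mem_sdiff, Finset.mem_union, ← not_exists]
    tauto
  have h5 : (V.filter fun s => ∃ t, E s t) ∪ (V.filter fun s => ∃ t, N s t) ⊆ V :=
    Finset.union_subset (Finset.filter_subset _ _) (Finset.filter_subset _ _)
  rw [h2, Finset.card_union_of_disjoint h3] at h1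
  have h6 := Finset.card_sdiff_add_card_eq_card h5
  rw [h4]
  omega

/-- The relation between diagonally opposite squares of a block, in the north-east direction. -/
def Diag (E N : S → S → Prop) (s x : S) : Prop := ∃ t y, IsBlock E N s t x y

/-- Diagonals can be retraced without choice, so of two diagonals with a common end one contains the
other. -/
theorem diag_leftUnique (G : IsExactGrid E N) : Relator.LeftUnique (Diag E N) := by
  rintro s x x' ⟨t, y, hb⟩ ⟨t', y', hb'⟩
  obtain rfl := G.north.1 hb.2.1 hb'.2.1
  exact G.east.1 hb.1 hb'.1

/-- A diagonal that starts at a convex corner and does not end at a reflex one. -/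
theorem exists_good_diagonal [Fintype S] (G : IsExactGrid E N) {V : Finset S}
    (hE : ∀ s t, E s t → s ∈ V ∧ t ∈ V)
    (hcard : {s | s ∈ V ∧ (∃ t, E s t) ∧ (∃ t, N s t) ∧ ¬ ∃ t x y, IsBlock E N s t x y}.ncard <
      {s | s ∈ V ∧ (∀ t, ¬ E t s) ∧ ∀ t, ¬ N t s}.ncard) :
    ∃ a b, a ∈ V ∧ (∀ t, ¬ E t a) ∧ (∀ t, ¬ N t a) ∧ Relation.ReflTransGen (Diag E N) a b ∧
      ((∀ t, ¬ E b t) ∨ ∀ t, ¬ N b t) := by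
  classical
  rw [ncard_eq_card_filter, ncard_eq_card_filter] at hcard
  by_contra! hcon
  obtain ⟨X, Y, hX, hY⟩ := G.exists_position
  have hend : ∀ a, ∃ b, Relation.ReflTransGen (Diag E N) a b ∧ ¬ ∃ t x y, IsBlock E N b t x y := by
    intro a
    obtain ⟨b, hb, hmax⟩ := Finset.exists_max_image
      (Finset.univ.filter fun b => Relation.ReflTransGen (Diag E N) a b) X ⟨a, by simp; rfl⟩
    simp only [Finset.mem_filter, Finset.mem_univ, true_and] at hb hmax
    refine ⟨b, hb, fun ⟨t, x, y, h⟩ => ?_⟩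
    have h1 := hmax x (hb.tail ⟨t, y, h⟩)
    have h2 := hX _ _ h.1
    have h3 := hY _ _ h.2.1
    omega
  choose φ hφ hφ' using hend
  have hno : ∀ a a', (∀ t, ¬ E t a) → Relation.ReflTransGen (Diag E N) a' a → a' = a := by
    intro a a' ha h
    rcases Relation.ReflTransGen.cases_tail h with h | ⟨c, -, t, y, hb⟩
    · exact h.symm
    · exact absurd hb.2.2.2 (ha _)
  -- If every diagonal ended at a reflex corner, two of them would share their end. One start would
  -- then lie further along the other diagonal and have a western neighbor.
  obtain ⟨a, ha, a', ha', hne, heq⟩ := Finset.exists_ne_map_eq_of_card_lt_of_maps_to hcard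
    (f := φ) (by
      intro a ha
      simp only [Finset.coe_filter, Set.mem_ofPred_eq] at ha ⊢
      obtain ⟨⟨t, h1⟩, h2⟩ := hcon a (φ a) ha.1 ha.2.1 ha.2.2 (hφ a)
      exact ⟨(hE _ _ h1).1, ⟨t, h1⟩, h2, hφ' a⟩)
  simp only [Finset.mem_filter] at ha ha'
  have h1 := hφ a
  have h2 := hφ a'
  rw [← heq] at h2
  rw [← Relation.reflTransGen_swap] at h1 h2
  have hu : Relator.RightUnique (Function.swap (Diag E N)) := fun _ _ _ h h' =>
    G.diag_leftUnique h h'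
  rcases Relation.ReflTransGen.total_of_right_unique hu h1 h2 with h | h <;>
    rw [Relation.reflTransGen_swap] at h
  · exact hne (hno _ _ ha.2.1 h).symm
  · exact hne (hno _ _ ha'.2.1 h)

end IsExactGrid

/-! ### Zipping a grid along a good diagonal -/

theorem Relation.ReflTransGen.exists_chain {α : Type*} {r : α → α → Prop} {a b : α}
    (h : Relation.ReflTransGen r a b) :
    ∃ (m : ℕ) (s : ℕ → α), s 0 = a ∧ s m = b ∧ ∀ i < m, r (s i) (s (i + 1)) := by
  induction h with
  | refl => exact ⟨0, fun _ => a, rfl, rfl, by simp⟩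
  | @tail b c _ hbc ih =>
    obtain ⟨m, s, h0, hm, hs⟩ := ih
    refine ⟨m + 1, fun i => if i ≤ m then s i else c, by simp [h0], by simp, fun i hi => ?_⟩
    rcases Nat.lt_succ_iff_lt_or_eq.mp hi with h | rfl
    · simpa [h.le, Nat.succ_le_of_lt h] using hs i h
    · simpa [hm] using hbc

/-- The squares `s 0, …, s m` form a diagonal, in the north-east direction, which starts at a convex
corner and does not end at a reflex one; `u i` and `t i` are the eastern and the northern neighbors
of `s i`, for `i < m`. -/
structure IsGoodDiagonal {S : Type*} (E N : S → S → Prop) (m : ℕ) (s t u : ℕ → S) : Prop where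
  block : ∀ i < m, IsBlock E N (s i) (u i) (s (i + 1)) (t i)
  not_west : ∀ x, ¬ E x (s 0)
  not_south : ∀ x, ¬ N x (s 0)
  end_corner : (∀ x, ¬ E (s m) x) ∨ ∀ x, ¬ N (s m) x

section Zip

variable {S : Type*} (E N : S → S → Prop) (m : ℕ) (s t u : ℕ → S)

open Classical in
/-- The identification of the squares `t i` with the squares `u i`, for `i < m`. -/
noncomputable def zip (x : S) : S := if h : ∃ i < m, x = t i then u h.choose else x

/-- Eastern neighbors after `s 0, …, s (m - 1)` have been deleted, `s m` has been separated from
its western and southern neighbors, and `t i` has been identified with `u i`. -/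
def zipEast (a b : S) : Prop :=
  ∃ y, zip m t u y = b ∧ E a y ∧ (∀ i < m, a ≠ s i) ∧ ∀ i ≤ m, y ≠ s i

/-- Northern neighbors after `s 0, …, s (m - 1)` have been deleted, `s m` has been separated from
its western and southern neighbors, and `t i` has been identified with `u i`. -/
def zipNorth (a b : S) : Prop :=
  ∃ x, zip m t u x = a ∧ N x b ∧ (∀ i < m, x ≠ s i) ∧ ∀ i ≤ m, b ≠ s i

end Zip

namespace IsGoodDiagonal

variable {S : Type*} {E N : S → S → Prop} {m : ℕ} {s t u : ℕ → S}

theorem exists_position (D : IsGoodDiagonal E N m s t u) (G : IsExactGrid E N) : ∃ X Y : S → ℤ,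
    (∀ a b, E a b → X b = X a + 1 ∧ Y b = Y a) ∧ (∀ a b, N a b → X b = X a ∧ Y b = Y a + 1) ∧
    (∀ i ≤ m, X (s i) = i ∧ Y (s i) = i) ∧ (∀ i < m, X (t i) = i ∧ Y (t i) = i + 1) ∧
    ∀ i < m, X (u i) = i + 1 ∧ Y (u i) = i := by
  obtain ⟨X, Y, hX, hY⟩ := G.exists_position
  have hs : ∀ i ≤ m, X (s i) = X (s 0) + i ∧ Y (s i) = Y (s 0) + i := by
    intro i
    induction i with
    | zero => simp
    | succ i ih =>
      intro hi
      have h1 := ih (by omega)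
      have hb := D.block i (by omega)
      have h2 := hX _ _ hb.1
      have h3 := hY _ _ hb.2.1
      push_cast
      constructor <;> omega
  refine ⟨fun a => X a - X (s 0), fun a => Y a - Y (s 0), fun a b h => ?_, fun a b h => ?_,
    fun i hi => ?_, fun i hi => ?_, fun i hi => ?_⟩
  · have := hX a b h
    constructor <;> simp only <;> omega
  · have := hY a b h
    constructor <;> simp only <;> omega
  · have := hs i hi
    constructor <;> simp only <;> omega
  · have h1 := hs i hi.le
    have h2 := hY _ _ (D.block i hi).2.2.1
    constructor <;> simp only <;> omega
  · have h1 := hs i hi.le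
    have h2 := hX _ _ (D.block i hi).1
    constructor <;> simp only <;> omega

theorem s_inj (D : IsGoodDiagonal E N m s t u) (G : IsExactGrid E N)
    {i j : ℕ} (hi : i ≤ m) (hj : j ≤ m) (h : s i = s j) : i = j := by
  obtain ⟨X, Y, -, -, hs, -, -⟩ := D.exists_position G
  have h1 := hs i hi
  have h2 := hs j hj
  rw [h] at h1
  omega

theorem t_inj (D : IsGoodDiagonal E N m s t u) (G : IsExactGrid E N)
    {i j : ℕ} (hi : i < m) (hj : j < m) (h : t i = t j) : i = j := by
  obtain ⟨X, Y, -, -, -, ht, -⟩ := D.exists_position G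
  have h1 := ht i hi
  have h2 := ht j hj
  rw [h] at h1
  omega

theorem u_inj (D : IsGoodDiagonal E N m s t u) (G : IsExactGrid E N)
    {i j : ℕ} (hi : i < m) (hj : j < m) (h : u i = u j) : i = j := by
  obtain ⟨X, Y, -, -, -, -, hu⟩ := D.exists_position G
  have h1 := hu i hi
  have h2 := hu j hj
  rw [h] at h1
  omega

theorem t_ne_s (D : IsGoodDiagonal E N m s t u) (G : IsExactGrid E N)
    {i j : ℕ} (hi : i < m) (hj : j ≤ m) : t i ≠ s j := by
  obtain ⟨X, Y, -, -, hs, ht, -⟩ := D.exists_position G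
  intro h
  have h1 := ht i hi
  have h2 := hs j hj
  rw [h] at h1
  omega

theorem u_ne_s (D : IsGoodDiagonal E N m s t u) (G : IsExactGrid E N)
    {i j : ℕ} (hi : i < m) (hj : j ≤ m) : u i ≠ s j := by
  obtain ⟨X, Y, -, -, hs, -, hu⟩ := D.exists_position G
  intro h
  have h1 := hu i hi
  have h2 := hs j hj
  rw [h] at h1
  omega

theorem t_ne_u (D : IsGoodDiagonal E N m s t u) (G : IsExactGrid E N)
    {i j : ℕ} (hi : i < m) (hj : j < m) : t i ≠ u j := by
  obtain ⟨X, Y, -, -, -, ht, hu⟩ := D.exists_position G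
  intro h
  have h1 := ht i hi
  have h2 := hu j hj
  rw [h] at h1
  omega

theorem west_s (D : IsGoodDiagonal E N m s t u) (G : IsExactGrid E N)
    {x : S} {j : ℕ} (hj : j ≤ m) (h : E x (s j)) : ∃ i < m, j = i + 1 ∧ x = t i := by
  cases j with
  | zero => exact absurd h (D.not_west x)
  | succ i => exact ⟨i, hj, rfl, G.east.1 h (D.block i hj).2.2.2⟩

theorem south_s (D : IsGoodDiagonal E N m s t u) (G : IsExactGrid E N)
    {x : S} {j : ℕ} (hj : j ≤ m) (h : N x (s j)) : ∃ i < m, j = i + 1 ∧ x = u i := by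
  cases j with
  | zero => exact absurd h (D.not_south x)
  | succ i => exact ⟨i, hj, rfl, G.north.1 h (D.block i hj).2.1⟩

theorem east_s (D : IsGoodDiagonal E N m s t u) (G : IsExactGrid E N)
    {x : S} {i : ℕ} (hi : i < m) (h : E (s i) x) : x = u i :=
  G.east.2 h (D.block i hi).1

theorem north_s (D : IsGoodDiagonal E N m s t u) (G : IsExactGrid E N)
    {x : S} {i : ℕ} (hi : i < m) (h : N (s i) x) : x = t i :=
  G.north.2 h (D.block i hi).2.2.1

theorem east_t (D : IsGoodDiagonal E N m s t u) (G : IsExactGrid E N)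
    {x : S} {i : ℕ} (hi : i < m) (h : E (t i) x) : x = s (i + 1) :=
  G.east.2 h (D.block i hi).2.2.2

theorem south_t (D : IsGoodDiagonal E N m s t u) (G : IsExactGrid E N)
    {x : S} {i : ℕ} (hi : i < m) (h : N x (t i)) : x = s i :=
  G.north.1 h (D.block i hi).2.2.1

theorem west_u (D : IsGoodDiagonal E N m s t u) (G : IsExactGrid E N)
    {x : S} {i : ℕ} (hi : i < m) (h : E x (u i)) : x = s i :=
  G.east.1 h (D.block i hi).1

theorem north_u (D : IsGoodDiagonal E N m s t u) (G : IsExactGrid E N)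
    {x : S} {i : ℕ} (hi : i < m) (h : N (u i) x) : x = s (i + 1) :=
  G.north.2 h (D.block i hi).2.1

theorem zip_t (D : IsGoodDiagonal E N m s t u) (G : IsExactGrid E N)
    {i : ℕ} (hi : i < m) : zip m t u (t i) = u i := by
  have h : ∃ j < m, t i = t j := ⟨i, hi, rfl⟩
  rw [zip, dif_pos h, ← D.t_inj G hi h.choose_spec.1 h.choose_spec.2]

theorem zip_of_ne {x : S} (h : ∀ i < m, x ≠ t i) : zip m t u x = x := by
  rw [zip, dif_neg]
  rintro ⟨i, hi, h'⟩
  exact h i hi h'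

theorem zip_u (D : IsGoodDiagonal E N m s t u) (G : IsExactGrid E N)
    {i : ℕ} (hi : i < m) : zip m t u (u i) = u i :=
  zip_of_ne fun _ hj => (D.t_ne_u G hj hi).symm

/-- The identification is injective except for the identification of `t i` with `u i`. -/
theorem eq_of_zip_eq (D : IsGoodDiagonal E N m s t u) (G : IsExactGrid E N)
    {x y : S} (h : zip m t u x = zip m t u y) :
    x = y ∨ ∃ i < m, x = t i ∧ y = u i ∨ x = u i ∧ y = t i := by
  by_cases hx : ∃ i < m, x = t i
  · obtain ⟨i, hi, rfl⟩ := hx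
    by_cases hy : ∃ i < m, y = t i
    · obtain ⟨j, hj, rfl⟩ := hy
      rw [D.zip_t G hi, D.zip_t G hj] at h
      rw [D.u_inj G hi hj h]
      exact Or.inl rfl
    · push Not at hy
      rw [D.zip_t G hi, zip_of_ne hy] at h
      exact Or.inr ⟨i, hi, Or.inl ⟨rfl, h.symm⟩⟩
  · push Not at hx
    by_cases hy : ∃ i < m, y = t i
    · obtain ⟨j, hj, rfl⟩ := hy
      rw [D.zip_t G hj, zip_of_ne hx] at h
      exact Or.inr ⟨j, hj, Or.inr ⟨h, rfl⟩⟩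
    · push Not at hy
      rw [zip_of_ne hx, zip_of_ne hy] at h
      exact Or.inl h

/-- The only square east of `t i` is `s (i + 1)`, so no surviving eastward step starts at a `t i`;
hence `zipEast` applies `zip` to the target alone. Likewise no surviving northward step ends at a `t
i`, whose only southern neighbor is `s i`. -/
theorem zip_of_east (D : IsGoodDiagonal E N m s t u) (G : IsExactGrid E N)
    {x y : S} (h : E x y) (hy : ∀ i ≤ m, y ≠ s i) : zip m t u x = x :=
  zip_of_ne fun i hi hx => hy (i + 1) hi (D.east_t G hi (hx ▸ h))

theorem zip_of_north (D : IsGoodDiagonal E N m s t u) (G : IsExactGrid E N)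
    {x y : S} (h : N x y) (hx : ∀ i < m, x ≠ s i) : zip m t u y = y :=
  zip_of_ne fun i hi hy => hx i hi (D.south_t G hi (hy ▸ h))

theorem zipEast_zip (D : IsGoodDiagonal E N m s t u) (G : IsExactGrid E N)
    {x y : S} (h : E x y) (hx : ∀ i < m, x ≠ s i) (hy : ∀ i ≤ m, y ≠ s i) :
    zipEast E m s t u (zip m t u x) (zip m t u y) := by
  rw [D.zip_of_east G h hy]
  exact ⟨y, rfl, h, hx, hy⟩

theorem zipNorth_zip (D : IsGoodDiagonal E N m s t u) (G : IsExactGrid E N)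
    {x y : S} (h : N x y) (hx : ∀ i < m, x ≠ s i) (hy : ∀ i ≤ m, y ≠ s i) :
    zipNorth N m s t u (zip m t u x) (zip m t u y) := by
  rw [D.zip_of_north G h hx]
  exact ⟨x, rfl, h, hx, hy⟩

theorem zipEast_biUnique (D : IsGoodDiagonal E N m s t u) (G : IsExactGrid E N) :
    Relator.BiUnique (zipEast E m s t u) := by
  constructor
  · rintro a c b ⟨y, hy, h1, h2, h3⟩ ⟨y', hy', h1', h2', h3'⟩
    rcases D.eq_of_zip_eq G (hy.trans hy'.symm) with rfl | ⟨i, hi, ⟨rfl, rfl⟩ | ⟨rfl, rfl⟩⟩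
    · exact G.east.1 h1 h1'
    · exact absurd (D.west_u G hi h1') (h2' i hi)
    · exact absurd (D.west_u G hi h1) (h2 i hi)
  · rintro a b c ⟨y, hy, h1, h2, h3⟩ ⟨y', hy', h1', h2', h3'⟩
    obtain rfl := G.east.2 h1 h1'
    exact hy.symm.trans hy'

theorem zipNorth_biUnique (D : IsGoodDiagonal E N m s t u) (G : IsExactGrid E N) :
    Relator.BiUnique (zipNorth N m s t u) := by
  constructor
  · rintro a c b ⟨y, hy, h1, h2, h3⟩ ⟨y', hy', h1', h2', h3'⟩
    obtain rfl := G.north.1 h1 h1'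
    exact hy.symm.trans hy'
  · rintro a b c ⟨y, hy, h1, h2, h3⟩ ⟨y', hy', h1', h2', h3'⟩
    rcases D.eq_of_zip_eq G (hy.trans hy'.symm) with rfl | ⟨i, hi, ⟨rfl, rfl⟩ | ⟨rfl, rfl⟩⟩
    · exact G.north.2 h1 h1'
    · exact absurd (D.north_u G hi h1') (h3' (i + 1) hi)
    · exact absurd (D.north_u G hi h1) (h3 (i + 1) hi)

/-- A block whose south-west square is on the diagonal is one of the blocks that form it. -/
theorem eq_of_block_southWest (D : IsGoodDiagonal E N m s t u) (G : IsExactGrid E N)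
    {p q x y : S} (hb : IsBlock E N p q x y) {i : ℕ} (hi : i ≤ m)
    (hp : p = s i) : i < m ∧ q = u i ∧ x = s (i + 1) ∧ y = t i := by
  subst hp
  have him : i < m := by
    rcases hi.lt_or_eq with h | rfl
    · exact h
    · rcases D.end_corner with h | h
      · exact absurd hb.1 (h _)
      · exact absurd hb.2.2.1 (h _)
  obtain rfl := D.east_s G him hb.1
  obtain rfl := D.north_s G him hb.2.2.1
  exact ⟨him, rfl, D.north_u G him hb.2.1, rfl⟩

theorem eq_of_block_northEast (D : IsGoodDiagonal E N m s t u) (G : IsExactGrid E N)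
    {p q x y : S} (hb : IsBlock E N p q x y) {j : ℕ} (hj : j ≤ m)
    (hx : x = s j) : ∃ i < m, j = i + 1 ∧ p = s i := by
  subst hx
  obtain ⟨i, hi, rfl, rfl⟩ := D.south_s G hj hb.2.1
  exact ⟨i, hi, rfl, D.west_u G hi hb.1⟩

/-- The compatibility of the values at the blocks to the north-west and to the south-east of a
square of the diagonal. -/
theorem exists_value (D : IsGoodDiagonal E N m s t u) (G : IsExactGrid E N)
    {A : Type} [AddCommGroup A] (f g : S → S → A)
    (H : ∀ p q x y, IsBlock (zipEast E m s t u) (zipNorth N m s t u) p q x y →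
      f p q + g q x = g p y + f y x) {j : ℕ} (hj : j ≤ m) (k₁ k₂ : S → A)
    (hk₁ : j < m → k₁ = 0) (hk₂ : j < m → k₂ = 0) :
    ∃ c : A, (∀ p x y, IsBlock E N p (s j) x y →
        c + k₁ x = g (zip m t u p) (zip m t u y) + f (zip m t u y) (zip m t u x)) ∧
      ∀ p q x, IsBlock E N p q x (s j) →
        f (zip m t u p) (zip m t u q) + g (zip m t u q) (zip m t u x) = c + k₂ x := by
  by_cases h₂ : ∃ p q x, IsBlock E N p q x (s j)
  · obtain ⟨p, q, x, hb⟩ := h₂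
    refine ⟨f (zip m t u p) (zip m t u q) + g (zip m t u q) (zip m t u x) - k₂ x,
      fun p' x' y' hb' => ?_, fun p' q' x' hb' => ?_⟩
    · have hjm : j < m := by
        rcases hj.lt_or_eq with h | rfl
        · exact h
        · rcases D.end_corner with h | h
          · exact absurd hb.2.2.2 (h _)
          · exact absurd hb'.2.1 (h _)
      rw [hk₁ hjm, hk₂ hjm, Pi.zero_apply, Pi.zero_apply, sub_zero, add_zero]
      obtain ⟨i, hi, rfl, rfl⟩ := D.south_s G hj hb.2.2.1
      obtain ⟨i', hi', hii, rfl⟩ := D.west_s G hj hb'.1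
      obtain rfl : i = i' := by omega
      obtain rfl := D.east_s G hjm hb.2.2.2
      obtain rfl := D.north_s G hjm hb'.2.1
      obtain ⟨X, Y, hX, hY, hs, ht, hu⟩ := D.exists_position G
      have e1 := hX _ _ hb.1
      have e2 := hY _ _ hb'.2.2.1
      have e3 := ht i hi
      have e4 := hu i hi
      have nq : ∀ k ≤ m, q ≠ s k := by
        rintro k hk rfl
        have := hs k hk
        omega
      have ny : ∀ k ≤ m, y' ≠ s k := by
        rintro k hk rfl
        have := hs k hk
        omega
      have b1 := D.zipEast_zip G hb.1 (fun k hk => D.u_ne_s G hi hk.le) nq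
      have b2 := D.zipNorth_zip G hb.2.1 (fun k hk => nq k hk.le)
        (fun k hk => D.u_ne_s G hjm hk)
      have b3 := D.zipNorth_zip G hb'.2.2.1 (fun k hk => D.t_ne_s G hi hk.le) ny
      have b4 := D.zipEast_zip G hb'.2.2.2 (fun k hk => ny k hk.le)
        (fun k hk => D.t_ne_s G hjm hk)
      rw [D.zip_t G hi] at b3 ⊢
      rw [D.zip_t G hjm] at b4 ⊢
      rw [D.zip_u G hi] at b1 ⊢
      rw [D.zip_u G hjm] at b2 ⊢
      exact H _ _ _ _ ⟨b1, b2, b3, b4⟩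
    · obtain rfl := G.north.1 hb.2.2.1 hb'.2.2.1
      obtain rfl := G.east.2 hb.1 hb'.1
      obtain rfl := G.north.2 hb.2.1 hb'.2.1
      rw [sub_add_cancel]
  · by_cases h₁ : ∃ p x y, IsBlock E N p (s j) x y
    · obtain ⟨p, x, y, hb⟩ := h₁
      refine ⟨g (zip m t u p) (zip m t u y) + f (zip m t u y) (zip m t u x) - k₁ x,
        fun p' x' y' hb' => ?_, fun p q x hb => absurd ⟨p, q, x, hb⟩ h₂⟩
      obtain rfl := G.east.1 hb.1 hb'.1
      obtain rfl := G.north.2 hb.2.1 hb'.2.1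
      obtain rfl := G.north.2 hb.2.2.1 hb'.2.2.1
      rw [sub_add_cancel]
    · exact ⟨0, fun p x y hb => absurd ⟨p, x, y, hb⟩ h₁, fun p q x hb => absurd ⟨p, q, x, hb⟩ h₂⟩

-- Pull a cochain back along `zip`, putting `0` on the steps that leave `s i` for `i < m` and a
-- common value `c (s j)`, found by `exists_value`, on the two possible steps into `s j`. A
-- primitive then takes equal values at `t i`, `s i` and `u i`, and so descends to the zipped grid.
open Classical in
theorem isExactGrid_zip (D : IsGoodDiagonal E N m s t u) (G : IsExactGrid E N) :
    IsExactGrid (zipEast E m s t u) (zipNorth N m s t u) where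
  east := D.zipEast_biUnique G
  north := D.zipNorth_biUnique G
  exact A _ f g H := by
    let π := zip m t u
    have hc : ∀ z, ∃ c : A, (∃ j ≤ m, z = s j) →
        (∀ p x y, IsBlock E N p z x y → c + (if ∃ i < m, z = s i then 0 else g (π z) (π x)) =
          g (π p) (π y) + f (π y) (π x)) ∧
        ∀ p q x, IsBlock E N p q x z → f (π p) (π q) + g (π q) (π x) =
          c + (if ∃ i < m, z = s i then 0 else f (π z) (π x)) := by
      intro z
      by_cases hz : ∃ j ≤ m, z = s j
      · obtain ⟨j, hj, rfl⟩ := hz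
        obtain ⟨c, hc⟩ := D.exists_value G f g H hj
          (fun x => if ∃ i < m, s j = s i then 0 else g (π (s j)) (π x))
          (fun x => if ∃ i < m, s j = s i then 0 else f (π (s j)) (π x))
          (fun h => funext fun x => if_pos ⟨j, h, rfl⟩)
          (fun h => funext fun x => if_pos ⟨j, h, rfl⟩)
        exact ⟨c, fun _ => hc⟩
      · exact ⟨0, fun h => absurd h hz⟩
    choose c hc using hc
    have not_lt : ∀ {z}, (¬ ∃ j ≤ m, z = s j) → ¬ ∃ j < m, z = s j :=
      fun h ⟨j, hj, h'⟩ => h ⟨j, hj.le, h'⟩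
    have all_le : ∀ {z}, (¬ ∃ j ≤ m, z = s j) → ∀ j ≤ m, z ≠ s j :=
      fun h j hj h' => h ⟨j, hj, h'⟩
    have all_lt : ∀ {z}, (¬ ∃ j ≤ m, z = s j) → ∀ j < m, z ≠ s j :=
      fun h j hj h' => h ⟨j, hj.le, h'⟩
    obtain ⟨h, h1, h2⟩ := G.exact A
      (fun a b => if ∃ j ≤ m, b = s j then c b else if ∃ i < m, a = s i then 0 else f (π a) (π b))
      (fun a b => if ∃ j ≤ m, b = s j then c b else if ∃ i < m, a = s i then 0 else g (π a) (π b))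
      (by
        intro p q x y hb
        by_cases hp : ∃ j ≤ m, p = s j
        · obtain ⟨i, hi, hp⟩ := hp
          obtain ⟨him, rfl, rfl, rfl⟩ := D.eq_of_block_southWest G hb hi hp
          subst hp
          have hu : ¬ ∃ j ≤ m, u i = s j := fun ⟨j, hj, h⟩ => D.u_ne_s G him hj h
          have ht : ¬ ∃ j ≤ m, t i = s j := fun ⟨j, hj, h⟩ => D.t_ne_s G him hj h
          have h1 : ∃ j < m, s i = s j := ⟨i, him, rfl⟩
          have h2 : ∃ j ≤ m, s (i + 1) = s j := ⟨i + 1, him, rfl⟩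
          simp only [if_neg hu, if_neg ht, if_pos h1, if_pos h2]
        have hx : ¬ ∃ j ≤ m, x = s j := by
          rintro ⟨j, hj, hx⟩
          obtain ⟨i, hi, -, h⟩ := D.eq_of_block_northEast G hb hj hx
          exact hp ⟨i, hi.le, h⟩
        by_cases hq : ∃ j ≤ m, q = s j
        · have hy : ¬ ∃ j ≤ m, y = s j := by
            rintro ⟨j, hj, rfl⟩
            obtain ⟨i, hi, rfl⟩ := hq
            obtain ⟨X, Y, hX, hY, hs, ht, hu⟩ := D.exists_position G
            have := hs i hi
            have := hs j hj
            have := hX _ _ hb.1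
            have := hY _ _ hb.2.2.1
            omega
          simp only [if_pos hq, if_neg hx, if_neg hy, if_neg (not_lt hp), if_neg (not_lt hy)]
          exact (hc q hq).1 p x y hb
        by_cases hy : ∃ j ≤ m, y = s j
        · simp only [if_pos hy, if_neg hx, if_neg hq, if_neg (not_lt hp), if_neg (not_lt hq)]
          exact (hc y hy).2 p q x hb
        · simp only [if_neg hy, if_neg hx, if_neg hq, if_neg (not_lt hp), if_neg (not_lt hq),
            if_neg (not_lt hy)]
          exact H _ _ _ _ ⟨D.zipEast_zip G hb.1 (all_lt hp) (all_le hq),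
            D.zipNorth_zip G hb.2.1 (all_lt hq) (all_le hx),
            D.zipNorth_zip G hb.2.2.1 (all_lt hp) (all_le hy),
            D.zipEast_zip G hb.2.2.2 (all_lt hy) (all_le hx)⟩)
    have hπ : ∀ x, h (π x) = h x := by
      intro x
      by_cases hx : ∃ i < m, x = t i
      · obtain ⟨i, hi, rfl⟩ := hx
        have e1 := h1 _ _ (D.block i hi).1
        have e2 := h2 _ _ (D.block i hi).2.2.1
        have hu : ¬ ∃ j ≤ m, u i = s j := fun ⟨j, hj, h⟩ => D.u_ne_s G hi hj h
        have ht : ¬ ∃ j ≤ m, t i = s j := fun ⟨j, hj, h⟩ => D.t_ne_s G hi hj h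
        rw [if_neg hu, if_pos ⟨i, hi, rfl⟩] at e1
        rw [if_neg ht, if_pos ⟨i, hi, rfl⟩, e1] at e2
        change h (zip m t u (t i)) = _
        rw [D.zip_t G hi]
        exact sub_left_injective e2
      · push Not at hx
        exact congrArg h (zip_of_ne hx)
    refine ⟨h, ?_, ?_⟩
    · rintro a b ⟨y, rfl, hab, ha, hy⟩
      have := h1 a y hab
      rw [if_neg (fun ⟨j, hj, h⟩ => hy j hj h), if_neg (fun ⟨j, hj, h⟩ => ha j hj h)] at this
      rw [show zip m t u y = π y from rfl, hπ, ← this]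
      exact congrArg₂ f (D.zip_of_east G hab hy).symm rfl
    · rintro a b ⟨x, rfl, hab, hx, hb⟩
      have := h2 x b hab
      rw [if_neg (fun ⟨j, hj, h⟩ => hb j hj h), if_neg (fun ⟨j, hj, h⟩ => hx j hj h)] at this
      rw [show zip m t u x = π x from rfl, hπ, ← this]
      exact congrArg₂ g rfl (D.zip_of_north G hab hx).symm

end IsGoodDiagonal

/-! ### Adjacency matrices and removal of leaves -/

/-- Being neighbors, in any direction. -/
def GridAdj {S : Type*} (E N : S → S → Prop) (a b : S) : Prop := E a b ∨ E b a ∨ N a b ∨ N b a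

open Classical in
/-- The adjacency matrix of neighbors. -/
noncomputable def gridMatrix {S : Type*} (E N : S → S → Prop) (a b : S) : ℤ :=
  if GridAdj E N a b then 1 else 0

/-- Neighbors are in different parts. -/
structure IsBipartition {S : Type*} (E N : S → S → Prop) (P Q : Finset S) : Prop where
  disjoint : ∀ x ∈ P, x ∉ Q
  east : ∀ a b, E a b → a ∈ P ∧ b ∈ Q ∨ a ∈ Q ∧ b ∈ P
  north : ∀ a b, N a b → a ∈ P ∧ b ∈ Q ∨ a ∈ Q ∧ b ∈ P

section

variable {S : Type*} {E N : S → S → Prop} {P Q : Finset S}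

theorem GridAdj.symm {a b : S} (h : GridAdj E N a b) : GridAdj E N b a := by
  unfold GridAdj at *
  tauto

theorem gridAdj_comm {a b : S} : GridAdj E N a b ↔ GridAdj E N b a := ⟨.symm, .symm⟩

theorem gridMatrix_comm (a b : S) : gridMatrix E N a b = gridMatrix E N b a := by
  unfold gridMatrix
  congr 1
  exact propext gridAdj_comm

theorem gridMatrix_flip (a b : S) : gridMatrix (flip E) (flip N) a b = gridMatrix E N a b := by
  have : GridAdj (flip E) (flip N) a b ↔ GridAdj E N a b := by
    unfold GridAdj flip
    tauto
  unfold gridMatrix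
  congr 1
  exact propext this

theorem gridMatrix_eq_zero_or (a b : S) :
    gridMatrix E N a b = 0 ∨ gridMatrix E N a b = 1 ∨ gridMatrix E N a b = -1 := by
  unfold gridMatrix
  split_ifs <;> simp

theorem gridMatrix_of_adj {a b : S} (h : GridAdj E N a b) : gridMatrix E N a b = 1 := if_pos h

theorem gridMatrix_of_not_adj {a b : S} (h : ¬ GridAdj E N a b) : gridMatrix E N a b = 0 := if_neg h

namespace IsBipartition

theorem swap (B : IsBipartition E N P Q) : IsBipartition E N Q P where
  disjoint x hx hx' := B.disjoint x hx' hx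
  east a b h := (B.east a b h).symm
  north a b h := (B.north a b h).symm

theorem flip (B : IsBipartition E N P Q) : IsBipartition (flip E) (flip N) P Q where
  disjoint := B.disjoint
  east a b h := by have := B.east b a h; tauto
  north a b h := by have := B.north b a h; tauto

theorem mem_left (B : IsBipartition E N P Q) {a b : S} (h : GridAdj E N a b) (hb : b ∈ Q) :
    a ∈ P := by
  have := B.disjoint b
  rcases h with h | h | h | h
  · have := B.east _ _ h; tauto
  · have := B.east _ _ h; tauto
  · have := B.north _ _ h; tauto
  · have := B.north _ _ h; tauto

theorem mem_right (B : IsBipartition E N P Q) {a b : S} (h : GridAdj E N a b) (ha : a ∈ P) :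
    b ∈ Q :=
  B.swap.mem_left h.symm ha

end IsBipartition

/-- Removal of a square with at most one neighbor, together with its neighbor. -/
theorem IsExactGrid.factorsOn_of_leaf (G : IsExactGrid E N) (B : IsBipartition E N P Q) {s : S}
    (hs : s ∈ Q) (hw : ∀ x, ¬ E x s) (hso : ∀ x, ¬ N x s) (hen : (∀ x, ¬ E s x) ∨ ∀ x, ¬ N s x)
    (ih : ∀ (E' N' : S → S → Prop) (P' Q' : Finset S), IsExactGrid E' N' →
      IsBipartition E' N' P' Q' → P'.card + Q'.card < P.card + Q.card →
      FactorsOn (gridMatrix E' N') P' Q') :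
    FactorsOn (gridMatrix E N) P Q := by
  classical
  by_cases hex : ∃ t, GridAdj E N t s
  · obtain ⟨t, ht⟩ := hex
    have htP := B.mem_left ht hs
    have hts : t ≠ s := by rintro rfl; exact B.disjoint _ htP hs
    have huniq : ∀ x, GridAdj E N x s → x = t := by
      have aux : ∀ x, GridAdj E N x s → E s x ∨ N s x := by
        rintro x (h | h | h | h)
        · exact absurd h (hw x)
        · exact Or.inl h
        · exact absurd h (hso x)
        · exact Or.inr h
      intro x hx
      rcases aux x hx with h | h <;> rcases aux t ht with h' | h'
      · exact G.east.2 h h'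
      · rcases hen with h0 | h0
        · exact absurd h (h0 _)
        · exact absurd h' (h0 _)
      · rcases hen with h0 | h0
        · exact absurd h' (h0 _)
        · exact absurd h (h0 _)
      · exact G.north.2 h h'
    have G₁ := G.delete (t := s) (Or.inr (Or.inl hw))
    -- Once `s` is gone, `t` lacks a neighbor on the side where `s` was, so it can be deleted too.
    have hside : (∀ x, ¬ (E x t ∧ x ≠ s ∧ t ≠ s)) ∨ ∀ x, ¬ (N x t ∧ x ≠ s ∧ t ≠ s) := by
      rcases ht with h | h | h | h
      · exact absurd h (hw t)
      · exact Or.inl fun x hx => hx.2.1 (G.east.1 hx.1 h)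
      · exact absurd h (hso t)
      · exact Or.inr fun x hx => hx.2.1 (G.north.1 hx.1 h)
    have G₂ := G₁.delete (t := t) (hside.elim (fun h => Or.inr (Or.inl h))
      fun h => Or.inr (Or.inr (Or.inr h)))
    refine FactorsOn.pivot (r := t) (c := s) htP hs (gridMatrix_of_adj ht)
      (fun _ _ => gridMatrix_eq_zero_or _ _) (fun _ _ => gridMatrix_eq_zero_or _ _) ?_
    refine (ih _ _ (P.erase t) (Q.erase s) G₂ ⟨fun x hx hx' => ?_, fun a b h => ?_,
      fun a b h => ?_⟩ ?_).congr fun x hx y hy => ?_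
    · exact B.disjoint x (Finset.mem_of_mem_erase hx) (Finset.mem_of_mem_erase hx')
    · have := B.east a b h.1.1
      simp only [Finset.mem_erase]
      tauto
    · have := B.north a b h.1.1
      simp only [Finset.mem_erase]
      tauto
    · have h1 := Finset.card_erase_lt_of_mem htP
      have h2 := Finset.card_erase_le (s := Q) (a := s)
      omega
    · rw [Finset.mem_erase] at hx hy
      have hxs : x ≠ s := by rintro rfl; exact B.disjoint _ hx.2 hs
      have hyt : y ≠ t := by rintro rfl; exact B.disjoint _ htP hy.2
      rw [gridMatrix_of_not_adj (a := x) (b := s) fun h => hx.1 (huniq x h), zero_mul, sub_zero]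
      unfold gridMatrix
      congr 1
      unfold GridAdj
      simp only [ne_eq, hxs, hyt, hx.1, hy.1, not_false_eq_true, and_true]
  · refine FactorsOn.zero_col hs (fun x _ => gridMatrix_of_not_adj fun h => hex ⟨x, h⟩) ?_
    refine ih _ _ P (Q.erase s) G ⟨fun x hx hx' => ?_, fun a b h => ?_, fun a b h => ?_⟩ ?_
    · exact B.disjoint x hx (Finset.mem_of_mem_erase hx')
    · have := B.east a b h
      have h1 : a ≠ s := by rintro rfl; exact hex ⟨b, Or.inr (Or.inl h)⟩
      have h2 : b ≠ s := by rintro rfl; exact hex ⟨a, Or.inl h⟩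
      simp only [Finset.mem_erase]
      tauto
    · have := B.north a b h
      have h1 : a ≠ s := by rintro rfl; exact hex ⟨b, Or.inr (Or.inr (Or.inr h))⟩
      have h2 : b ≠ s := by rintro rfl; exact hex ⟨a, Or.inr (Or.inr (Or.inl h))⟩
      simp only [Finset.mem_erase]
      tauto
    · have h1 := Finset.card_erase_lt_of_mem hs
      omega

end

/-! ### Gaussian elimination along the diagonal -/

namespace IsGoodDiagonal

variable {S : Type*} {E N : S → S → Prop} {m : ℕ} {s t u : ℕ → S} {P Q : Finset S}

theorem s_mem (D : IsGoodDiagonal E N m s t u) (B : IsBipartition E N P Q)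
    (hs : s 0 ∈ Q) {i : ℕ} (hi : i ≤ m) : s i ∈ Q := by
  induction i with
  | zero => exact hs
  | succ i ih =>
    have hb := D.block i hi
    have hu : u i ∈ P := B.mem_left (Or.inr (Or.inl hb.1)) (ih (by omega))
    exact B.mem_right (Or.inr (Or.inr (Or.inl hb.2.1))) hu

theorem u_mem (D : IsGoodDiagonal E N m s t u) (B : IsBipartition E N P Q)
    (hs : s 0 ∈ Q) {i : ℕ} (hi : i < m) : u i ∈ P :=
  B.mem_left (Or.inr (Or.inl (D.block i hi).1)) (D.s_mem B hs hi.le)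

theorem t_mem (D : IsGoodDiagonal E N m s t u) (B : IsBipartition E N P Q)
    (hs : s 0 ∈ Q) {i : ℕ} (hi : i < m) : t i ∈ P :=
  B.mem_left (Or.inr (Or.inr (Or.inr (D.block i hi).2.2.1))) (D.s_mem B hs hi.le)

theorem gridAdj_t_s (D : IsGoodDiagonal E N m s t u) (G : IsExactGrid E N)
    {i j : ℕ} (hi : i < m) (hj : j ≤ m) :
    GridAdj E N (t i) (s j) ↔ j = i ∨ j = i + 1 := by
  constructor
  · obtain ⟨X, Y, hX, hY, hs, ht, hu⟩ := D.exists_position G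
    have h1 := hs j hj
    have h2 := ht i hi
    rintro (h | h | h | h)
    · have := hX _ _ h; omega
    · have := hX _ _ h; omega
    · have := hY _ _ h; omega
    · have := hY _ _ h; omega
  · rintro (rfl | rfl)
    · exact Or.inr (Or.inr (Or.inr (D.block j hi).2.2.1))
    · exact Or.inl (D.block i hi).2.2.2

theorem gridAdj_u_s (D : IsGoodDiagonal E N m s t u) (G : IsExactGrid E N)
    {i j : ℕ} (hi : i < m) (hj : j ≤ m) :
    GridAdj E N (u i) (s j) ↔ j = i ∨ j = i + 1 := by
  constructor
  · obtain ⟨X, Y, hX, hY, hs, ht, hu⟩ := D.exists_position G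
    have h1 := hs j hj
    have h2 := hu i hi
    rintro (h | h | h | h)
    · have := hX _ _ h; omega
    · have := hX _ _ h; omega
    · have := hY _ _ h; omega
    · have := hY _ _ h; omega
  · rintro (rfl | rfl)
    · exact Or.inr (Or.inl (D.block j hi).1)
    · exact Or.inr (Or.inr (Or.inl (D.block i hi).2.1))

/-- Rows `u i` and `t i` agree on the whole diagonal, including `s m`. Their difference thus
vanishes there, which is why the zipped grid cuts `s m` from its western and southern neighbors. -/
theorem gridMatrix_u_s (D : IsGoodDiagonal E N m s t u) (G : IsExactGrid E N)
    {i j : ℕ} (hi : i < m) (hj : j ≤ m) :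
    gridMatrix E N (u i) (s j) = gridMatrix E N (t i) (s j) := by
  unfold gridMatrix
  simp only [D.gridAdj_t_s G hi hj, D.gridAdj_u_s G hi hj]

open Classical in
/-- The matrix after the first `j` eliminations along the diagonal. -/
noncomputable def eliminated (E N : S → S → Prop) (t u : ℕ → S) (j : ℕ) (x y : S) : ℤ :=
  gridMatrix E N x y - ∑ i ∈ Finset.range j, if x = u i then gridMatrix E N (t i) y else 0

theorem eliminated_u (D : IsGoodDiagonal E N m s t u) (G : IsExactGrid E N)
    {i j : ℕ} (hi : i < j) (hj : j ≤ m) (y : S) :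
    eliminated E N t u j (u i) y = gridMatrix E N (u i) y - gridMatrix E N (t i) y := by
  unfold eliminated
  congr 1
  rw [Finset.sum_eq_single i]
  · simp
  · intro k hk hki
    rw [if_neg]
    intro h
    exact hki (D.u_inj G (by omega) (by have := Finset.mem_range.mp hk; omega) h).symm
  · intro h
    exact absurd (Finset.mem_range.mpr hi) h

theorem eliminated_of_ne {j : ℕ} {x : S} (hx : ∀ i < j, x ≠ u i) (y : S) :
    eliminated E N t u j x y = gridMatrix E N x y := by
  unfold eliminated
  rw [Finset.sum_eq_zero, sub_zero]
  intro i hi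
  rw [if_neg (hx i (Finset.mem_range.mp hi))]

-- Of the four possible neighbors of `s j`, the western one `t (j - 1)` has already served as a
-- pivot row and the southern one `u (j - 1)` has been cancelled. Hence pivoting at `t j` affects
-- row `u j` only.
open Classical in
theorem eliminated_s (D : IsGoodDiagonal E N m s t u) (G : IsExactGrid E N)
    {j : ℕ} (hj : j < m) {x : S} (hx : ∀ i < j, x ≠ t i) :
    eliminated E N t u j x (s j) = if x = t j ∨ x = u j then 1 else 0 := by
  by_cases hu : ∃ i < j, x = u i
  · obtain ⟨i, hi, rfl⟩ := hu
    rw [D.eliminated_u G hi hj.le, D.gridMatrix_u_s G (by omega) hj.le, sub_self, if_neg]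
    rintro (h | h)
    · exact D.t_ne_u G hj (by omega) h.symm
    · exact hi.ne (D.u_inj G (by omega) hj h)
  · push Not at hu
    rw [eliminated_of_ne hu]
    unfold gridMatrix
    congr 1
    refine propext ⟨?_, ?_⟩
    · rintro (h | h | h | h)
      · obtain ⟨i, hi, hji, rfl⟩ := D.west_s G hj.le h
        exact absurd rfl (hx i (by omega))
      · exact Or.inr (D.east_s G hj h)
      · obtain ⟨i, hi, hji, rfl⟩ := D.south_s G hj.le h
        exact absurd rfl (hu i (by omega))
      · exact Or.inl (D.north_s G hj h)
    · rintro (rfl | rfl)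
      · exact (D.gridAdj_t_s G hj hj.le).mpr (Or.inl rfl)
      · exact (D.gridAdj_u_s G hj hj.le).mpr (Or.inl rfl)

open Classical in
/-- Elimination along the diagonal. -/
theorem factorsOn_of_eliminated (D : IsGoodDiagonal E N m s t u) (G : IsExactGrid E N)
    (B : IsBipartition E N P Q) (hs : s 0 ∈ Q) {j : ℕ} (hj : j ≤ m)
    (h : FactorsOn (eliminated E N t u j) (P.filter fun x => ∀ i < j, x ≠ t i)
      (Q.filter fun y => ∀ i < j, y ≠ s i)) : FactorsOn (gridMatrix E N) P Q := by
  induction j with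
  | zero =>
    simp only [Nat.not_lt_zero, false_imp_iff, implies_true, Finset.filter_true] at h
    exact h.congr fun x _ y _ => by simp [eliminated]
  | succ j ih =>
    have hjm : j < m := hj
    have ht : t j ∈ P.filter fun x => ∀ i < j, x ≠ t i := by
      rw [Finset.mem_filter]
      exact ⟨D.t_mem B hs hjm, fun i hi h => hi.ne' (D.t_inj G hjm (by omega) h)⟩
    have htu : ∀ i < j, t j ≠ u i := fun i hi => D.t_ne_u G hjm (by omega)
    refine ih hjm.le (FactorsOn.pivot (r := t j) (c := s j) ht ?_ ?_ ?_ ?_ ?_)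
    · rw [Finset.mem_filter]
      exact ⟨D.s_mem B hs hjm.le, fun i hi h => hi.ne' (D.s_inj G hjm.le (by omega) h)⟩
    · rw [D.eliminated_s G hjm (Finset.mem_filter.mp ht).2, if_pos (Or.inl rfl)]
    · intro x hx
      rw [D.eliminated_s G hjm (Finset.mem_filter.mp hx).2]
      split_ifs <;> simp
    · intro y _
      rw [eliminated_of_ne htu]
      exact gridMatrix_eq_zero_or _ _
    · have e1 : (P.filter fun x => ∀ i < j, x ≠ t i).erase (t j) =
          P.filter fun x => ∀ i < j + 1, x ≠ t i := by
        ext x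
        simp only [Finset.mem_erase, Finset.mem_filter, Nat.lt_succ_iff_lt_or_eq, or_imp,
          forall_and, forall_eq]
        tauto
      have e2 : (Q.filter fun x => ∀ i < j, x ≠ s i).erase (s j) =
          Q.filter fun x => ∀ i < j + 1, x ≠ s i := by
        ext x
        simp only [Finset.mem_erase, Finset.mem_filter, Nat.lt_succ_iff_lt_or_eq, or_imp,
          forall_and, forall_eq]
        tauto
      rw [e1, e2]
      refine h.congr fun x hx y hy => ?_
      have hx' := (Finset.mem_filter.mp hx).2
      rw [D.eliminated_s G hjm fun i hi => hx' i (by omega), eliminated_of_ne htu]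
      simp only [hx' j (by omega), false_or]
      unfold eliminated
      rw [Finset.sum_range_succ]
      split_ifs <;> ring

end IsGoodDiagonal

/-! ### Signs and comparison with the zipped grid -/

namespace IsGoodDiagonal

variable {S : Type*} {E N : S → S → Prop} {m : ℕ} {s t u : ℕ → S} {P Q : Finset S}

open Classical in
/-- A function that is constant on each side of the diagonal, with a jump across it. -/
theorem exists_height (D : IsGoodDiagonal E N m s t u) (G : IsExactGrid E N) : ∃ h : S → ℤ,
    (∀ a b, E a b → h b = h a - if ∃ j ≤ m, b = s j then 1 else 0) ∧
    ∀ a b, N a b → h b = h a + if ∃ j ≤ m, a = s j then 1 else 0 := by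
  obtain ⟨h, h1, h2⟩ := G.exact ℤ (fun _ b => - if ∃ j ≤ m, b = s j then 1 else 0)
    (fun a _ => if ∃ j ≤ m, a = s j then 1 else 0) (by
      intro p q x y hb
      -- On a block the two contributions of the south-eastern square cancel. Closedness says that
      -- the north-eastern square is on the diagonal exactly when the south-western one is.
      have : (∃ j ≤ m, x = s j) ↔ ∃ j ≤ m, p = s j := by
        constructor
        · rintro ⟨j, hj, hx⟩
          obtain ⟨i, hi, -, hp⟩ := D.eq_of_block_northEast G hb hj hx
          exact ⟨i, hi.le, hp⟩
        · rintro ⟨i, hi, hp⟩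
          obtain ⟨him, -, hx, -⟩ := D.eq_of_block_southWest G hb hi hp
          exact ⟨i + 1, him, hx⟩
      simp only [this]
      ring)
  refine ⟨h, fun a b hab => ?_, fun a b hab => ?_⟩
  · have := h1 a b hab
    linarith
  · have := h2 a b hab
    linarith

theorem zip_of_mem_right (D : IsGoodDiagonal E N m s t u) (B : IsBipartition E N P Q)
    (hs : s 0 ∈ Q) {y : S} (hy : y ∈ Q) : zip m t u y = y :=
  zip_of_ne fun _ hi h => B.disjoint _ (D.t_mem B hs hi) (h ▸ hy)

theorem zip_eq_right (D : IsGoodDiagonal E N m s t u) (G : IsExactGrid E N)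
    (B : IsBipartition E N P Q) (hs : s 0 ∈ Q) {x y : S} (hy : y ∈ Q) (h : zip m t u x = y) :
    x = y := by
  rw [← D.zip_of_mem_right B hs hy] at h
  rcases D.eq_of_zip_eq G h with h | ⟨i, hi, ⟨-, h⟩ | ⟨-, h⟩⟩
  · exact h
  · exact absurd (h ▸ hy) (B.disjoint _ (D.u_mem B hs hi))
  · exact absurd (h ▸ hy) (B.disjoint _ (D.t_mem B hs hi))

theorem zip_eq_left (D : IsGoodDiagonal E N m s t u) (G : IsExactGrid E N)
    {x y : S} (hx : ∀ i < m, x ≠ t i) :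
    zip m t u y = x ↔ y = x ∨ ∃ i < m, x = u i ∧ y = t i := by
  constructor
  · intro h
    rw [← zip_of_ne (u := u) hx] at h
    rcases D.eq_of_zip_eq G h with h | ⟨i, hi, ⟨h, h'⟩ | ⟨-, h⟩⟩
    · exact Or.inl h
    · exact Or.inr ⟨i, hi, h', h⟩
    · exact absurd h (hx i hi)
  · rintro (rfl | ⟨i, hi, rfl, rfl⟩)
    · exact zip_of_ne hx
    · exact D.zip_t G hi

theorem gridAdj_zip_iff (D : IsGoodDiagonal E N m s t u) (G : IsExactGrid E N)
    (B : IsBipartition E N P Q) (hs : s 0 ∈ Q) {x y : S} (hx : x ∈ P) (hxt : ∀ i < m, x ≠ t i)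
    (hy : y ∈ Q) (hys : ∀ i < m, y ≠ s i) :
    GridAdj (zipEast E m s t u) (zipNorth N m s t u) x y ↔
      (E x y ∧ y ≠ s m ∨ E y x ∨ N x y ∧ y ≠ s m ∨ N y x) ∨
      ∃ i < m, x = u i ∧ (E y (t i) ∨ N (t i) y ∧ y ≠ s m) := by
  have hxs : ∀ i ≤ m, x ≠ s i := fun i hi h => B.disjoint x hx (h ▸ D.s_mem B hs hi)
  have hys' : y ≠ s m ↔ ∀ i ≤ m, y ≠ s i := by
    refine ⟨fun h i hi => ?_, fun h => h m le_rfl⟩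
    rcases hi.lt_or_eq with h' | rfl
    · exact hys i h'
    · exact h
  have e1 : zipEast E m s t u x y ↔ E x y ∧ y ≠ s m := by
    constructor
    · rintro ⟨z, hz, h, -, hzs⟩
      obtain rfl := D.zip_eq_right G B hs hy hz
      exact ⟨h, hzs m le_rfl⟩
    · rintro ⟨h, hym⟩
      exact ⟨y, D.zip_of_mem_right B hs hy, h, fun i hi => hxs i hi.le, hys'.mp hym⟩
  have e2 : zipEast E m s t u y x ↔ E y x ∨ ∃ i < m, x = u i ∧ E y (t i) := by
    constructor
    · rintro ⟨z, hz, h, -, -⟩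
      rcases (D.zip_eq_left G hxt).mp hz with rfl | ⟨i, hi, rfl, rfl⟩
      · exact Or.inl h
      · exact Or.inr ⟨i, hi, rfl, h⟩
    · rintro (h | ⟨i, hi, rfl, h⟩)
      · exact ⟨x, zip_of_ne hxt, h, hys, hxs⟩
      · exact ⟨t i, D.zip_t G hi, h, hys, fun j hj => D.t_ne_s G hi hj⟩
  have e3 : zipNorth N m s t u x y ↔ N x y ∧ y ≠ s m ∨ ∃ i < m, x = u i ∧ N (t i) y ∧ y ≠ s m := by
    constructor
    · rintro ⟨z, hz, h, -, hzs⟩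
      rcases (D.zip_eq_left G hxt).mp hz with rfl | ⟨i, hi, rfl, rfl⟩
      · exact Or.inl ⟨h, hzs m le_rfl⟩
      · exact Or.inr ⟨i, hi, rfl, h, hzs m le_rfl⟩
    · rintro (⟨h, hym⟩ | ⟨i, hi, rfl, h, hym⟩)
      · exact ⟨x, zip_of_ne hxt, h, fun i hi => hxs i hi.le, hys'.mp hym⟩
      · exact ⟨t i, D.zip_t G hi, h, fun j hj => D.t_ne_s G hi hj.le, hys'.mp hym⟩
  have e4 : zipNorth N m s t u y x ↔ N y x := by
    constructor
    · rintro ⟨z, hz, h, -, -⟩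
      obtain rfl := D.zip_eq_right G B hs hy hz
      exact h
    · intro h
      exact ⟨y, D.zip_of_mem_right B hs hy, h, hys, hxs⟩
  unfold GridAdj
  rw [e1, e2, e3, e4]
  constructor
  · rintro (h | (h | ⟨i, hi, h1, h2⟩) | (h | ⟨i, hi, h1, h2⟩) | h)
    · exact Or.inl (Or.inl h)
    · exact Or.inl (Or.inr (Or.inl h))
    · exact Or.inr ⟨i, hi, h1, Or.inl h2⟩
    · exact Or.inl (Or.inr (Or.inr (Or.inl h)))
    · exact Or.inr ⟨i, hi, h1, Or.inr h2⟩
    · exact Or.inl (Or.inr (Or.inr (Or.inr h)))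
  · rintro ((h | h | h | h) | ⟨i, hi, h1, h2 | h2⟩)
    · exact Or.inl h
    · exact Or.inr (Or.inl (Or.inl h))
    · exact Or.inr (Or.inr (Or.inl (Or.inl h)))
    · exact Or.inr (Or.inr (Or.inr h))
    · exact Or.inr (Or.inl (Or.inr ⟨i, hi, h1, h2⟩))
    · exact Or.inr (Or.inr (Or.inl (Or.inr ⟨i, hi, h1, h2⟩)))

open Classical in
theorem isBipartition_zip (D : IsGoodDiagonal E N m s t u) (G : IsExactGrid E N)
    (B : IsBipartition E N P Q) (hs : s 0 ∈ Q) :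
    IsBipartition (zipEast E m s t u) (zipNorth N m s t u)
      (P.filter fun x => ∀ i < m, x ≠ t i) (Q.filter fun y => ∀ i < m, y ≠ s i) := by
  have hzip : ∀ x ∈ P, zip m t u x ∈ P.filter fun x => ∀ i < m, x ≠ t i := by
    intro x hx
    rw [Finset.mem_filter]
    by_cases h : ∃ i < m, x = t i
    · obtain ⟨i, hi, rfl⟩ := h
      rw [D.zip_t G hi]
      exact ⟨D.u_mem B hs hi, fun j hj => (D.t_ne_u G hj hi).symm⟩
    · push Not at h
      rw [zip_of_ne h]
      exact ⟨hx, h⟩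
  refine ⟨fun x hx hx' => B.disjoint x (Finset.mem_of_mem_filter _ hx)
    (Finset.mem_of_mem_filter _ hx'), ?_, ?_⟩
  · rintro a b ⟨y, rfl, h, ha, hy⟩
    rcases B.east a y h with ⟨h1, h2⟩ | ⟨h1, h2⟩
    · left
      rw [D.zip_of_mem_right B hs h2]
      have := hzip a h1
      rw [D.zip_of_east G h hy] at this
      exact ⟨this, Finset.mem_filter.mpr ⟨h2, fun i hi => hy i hi.le⟩⟩
    · exact Or.inr ⟨Finset.mem_filter.mpr ⟨h1, ha⟩, hzip y h2⟩
  · rintro a b ⟨x, rfl, h, hx, hb⟩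
    rcases B.north x b h with ⟨h1, h2⟩ | ⟨h1, h2⟩
    · exact Or.inl ⟨hzip x h1, Finset.mem_filter.mpr ⟨h2, fun i hi => hb i hi.le⟩⟩
    · right
      rw [D.zip_of_mem_right B hs h1]
      have := hzip b h2
      rw [D.zip_of_north G h hx] at this
      exact ⟨Finset.mem_filter.mpr ⟨h1, hx⟩, this⟩

open Classical in
/-- After the elimination, the matrix is, up to signs, the one of the zipped grid. -/
theorem exists_sign (D : IsGoodDiagonal E N m s t u) (G : IsExactGrid E N)
    (B : IsBipartition E N P Q) (hs : s 0 ∈ Q) : ∃ ε : S → ℤ, (∀ x, ε x = 1 ∨ ε x = -1) ∧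
    ∀ x ∈ P.filter fun x => ∀ i < m, x ≠ t i, ∀ y ∈ Q.filter fun y => ∀ i < m, y ≠ s i,
      eliminated E N t u m x y =
        ε x * gridMatrix (zipEast E m s t u) (zipNorth N m s t u) x y * ε y := by
  obtain ⟨h, hE, hN⟩ := D.exists_height G
  -- The diagonal has the height of its south-eastern side. If `s m` has a northern neighbor, it has
  -- no eastern one, and it must be raised to the height of that neighbor; its western and southern
  -- steps are cut and impose nothing.
  let k : S → ℤ := fun x => h x + if x = s m ∧ ∃ y, N (s m) y then 1 else 0
  have hk : ∀ x, x ≠ s m → k x = h x := fun x hx => by simp [k, hx]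
  let ε : S → ℤ := fun x => ((k x).negOnePow : ℤˣ)
  have hε : ∀ x, ε x = 1 ∨ ε x = -1 := by
    intro x
    rcases Int.units_eq_one_or (k x).negOnePow with h | h <;> simp [ε, h]
  have hsame : ∀ {x y}, k x = k y → ε x * 1 * ε y = 1 := by
    intro x y hxy
    rcases hε x with h | h <;> simp only [ε, hxy] at h ⊢ <;> simp [h]
  have hopp : ∀ {x y}, k y = k x + 1 → ε x * 1 * ε y = -1 := by
    intro x y hxy
    rcases hε x with h | h <;> simp only [ε, hxy, Int.negOnePow_succ, Units.val_neg] at h ⊢ <;>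
      simp [h]
  have hnot : ∀ {x}, (∀ i ≤ m, x ≠ s i) → ¬ ∃ i ≤ m, x = s i := fun h ⟨i, hi, h'⟩ => h i hi h'
  refine ⟨ε, hε, fun x hx y hy => ?_⟩
  obtain ⟨hxP, hxt⟩ := Finset.mem_filter.mp hx
  obtain ⟨hyQ, hys⟩ := Finset.mem_filter.mp hy
  have hxs : ∀ i ≤ m, x ≠ s i := fun i hi h => B.disjoint x hxP (h ▸ D.s_mem B hs hi)
  have hkx : k x = h x := hk x (hxs m le_rfl)
  have key := D.gridAdj_zip_iff G B hs hxP hxt hyQ hys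
  by_cases hxu : ∃ i < m, x = u i
  · obtain ⟨i, hi, rfl⟩ := hxu
    rw [D.eliminated_u G hi le_rfl]
    have hut : h (t i) = h (u i) + 1 := by
      have h1 := hE _ _ (D.block i hi).1
      have h2 := hN _ _ (D.block i hi).2.2.1
      rw [if_neg (hnot fun j hj => D.u_ne_s G hi hj)] at h1
      rw [if_pos ⟨i, hi.le, rfl⟩] at h2
      omega
    by_cases hym : y = s m
    · subst hym
      rw [D.gridMatrix_u_s G hi le_rfl, sub_self, gridMatrix_of_not_adj (a := u i) (b := s m)]
      · simp
      · rw [key]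
        obtain ⟨X, Y, hX, hY, ps, pt, pu⟩ := D.exists_position G
        have p1 := ps m le_rfl
        have p2 := pu i hi
        rintro ((h | h | h | h) | ⟨j, hj, -, h | h⟩)
        · exact h.2 rfl
        · have := hX _ _ h; omega
        · exact h.2 rfl
        · have := hY _ _ h; omega
        · have := hX _ _ h
          have := pt j hj
          omega
        · exact h.2 rfl
    · have hky := hk y hym
      have hys' : ∀ j ≤ m, y ≠ s j := fun j hj => by
        rcases hj.lt_or_eq with h' | rfl
        · exact hys j h'
        · exact hym
      have hu_iff : GridAdj E N (u i) y ↔ E (u i) y ∨ N y (u i) := by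
        constructor
        · rintro (h | h | h | h)
          · exact Or.inl h
          · exact absurd (D.west_u G hi h) (hys i hi)
          · exact absurd (D.north_u G hi h) (hys' _ hi)
          · exact Or.inr h
        · rintro (h | h)
          · exact Or.inl h
          · exact Or.inr (Or.inr (Or.inr h))
      have ht_iff : GridAdj E N (t i) y ↔ E y (t i) ∨ N (t i) y := by
        constructor
        · rintro (h | h | h | h)
          · exact absurd (D.east_t G hi h) (hys' _ hi)
          · exact Or.inl h
          · exact Or.inr h
          · exact absurd (D.south_t G hi h) (hys i hi)
        · rintro (h | h)
          · exact Or.inr (Or.inl h)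
          · exact Or.inr (Or.inr (Or.inl h))
      have hu_val : GridAdj E N (u i) y → h y = h (u i) := by
        rw [hu_iff]
        rintro (h | h)
        · have := hE _ _ h
          rw [if_neg (hnot hys')] at this
          omega
        · have := hN _ _ h
          rw [if_neg (hnot hys')] at this
          omega
      have ht_val : GridAdj E N (t i) y → h y = h (u i) + 1 := by
        rw [ht_iff]
        rintro (h | h)
        · have := hE _ _ h
          rw [if_neg (hnot fun j hj => D.t_ne_s G hi hj)] at this
          omega
        · have := hN _ _ h
          rw [if_neg (hnot fun j hj => D.t_ne_s G hi hj)] at this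
          omega
      have key' : GridAdj (zipEast E m s t u) (zipNorth N m s t u) (u i) y ↔
          GridAdj E N (u i) y ∨ GridAdj E N (t i) y := by
        rw [key, ht_iff]
        constructor
        · rintro ((h | h | h | h) | ⟨j, hj, hij, h⟩)
          · exact Or.inl (Or.inl h.1)
          · exact Or.inl (Or.inr (Or.inl h))
          · exact Or.inl (Or.inr (Or.inr (Or.inl h.1)))
          · exact Or.inl (Or.inr (Or.inr (Or.inr h)))
          · obtain rfl := D.u_inj G hi hj hij
            exact Or.inr (h.imp id And.left)
        · rintro ((h | h | h | h) | h)
          · exact Or.inl (Or.inl ⟨h, hym⟩)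
          · exact Or.inl (Or.inr (Or.inl h))
          · exact Or.inl (Or.inr (Or.inr (Or.inl ⟨h, hym⟩)))
          · exact Or.inl (Or.inr (Or.inr (Or.inr h)))
          · exact Or.inr ⟨i, hi, rfl, h.imp id fun h => ⟨h, hym⟩⟩
      by_cases hu : GridAdj E N (u i) y
      · have ht : ¬ GridAdj E N (t i) y := fun ht => by
          have := hu_val hu
          have := ht_val ht
          omega
        rw [gridMatrix_of_adj hu, gridMatrix_of_not_adj ht,
          gridMatrix_of_adj (key'.mpr (Or.inl hu)),
          hsame (by rw [hkx, hky, hu_val hu]), sub_zero]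
      · by_cases ht : GridAdj E N (t i) y
        · rw [gridMatrix_of_adj ht, gridMatrix_of_not_adj hu,
            gridMatrix_of_adj (key'.mpr (Or.inr ht)), hopp (by rw [hkx, hky, ht_val ht]), zero_sub]
        · rw [gridMatrix_of_not_adj ht, gridMatrix_of_not_adj hu,
            gridMatrix_of_not_adj fun h => (key'.mp h).elim hu ht]
          simp
  · push Not at hxu
    rw [eliminated_of_ne hxu]
    have hE' : E x y → y ≠ s m := by
      rintro h rfl
      obtain ⟨i, hi, -, h'⟩ := D.west_s G le_rfl h
      exact hxt i hi h'
    have hN' : N x y → y ≠ s m := by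
      rintro h rfl
      obtain ⟨i, hi, -, h'⟩ := D.south_s G le_rfl h
      exact hxu i hi h'
    have key' : GridAdj (zipEast E m s t u) (zipNorth N m s t u) x y ↔ GridAdj E N x y := by
      rw [key]
      unfold GridAdj
      constructor
      · rintro ((h | h | h | h) | ⟨i, hi, h, -⟩)
        · exact Or.inl h.1
        · exact Or.inr (Or.inl h)
        · exact Or.inr (Or.inr (Or.inl h.1))
        · exact Or.inr (Or.inr (Or.inr h))
        · exact absurd h (hxu i hi)
      · rintro (h | h | h | h)
        · exact Or.inl (Or.inl ⟨h, hE' h⟩)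
        · exact Or.inl (Or.inr (Or.inl h))
        · exact Or.inl (Or.inr (Or.inr (Or.inl ⟨h, hN' h⟩)))
        · exact Or.inl (Or.inr (Or.inr (Or.inr h)))
    by_cases hxy : GridAdj E N x y
    · rw [gridMatrix_of_adj hxy, gridMatrix_of_adj (key'.mpr hxy), hsame]
      rw [hkx]
      have hym_iff : y ≠ s m → ∀ j ≤ m, y ≠ s j := fun hym j hj => by
        rcases hj.lt_or_eq with h' | rfl
        · exact hys j h'
        · exact hym
      rcases hxy with h | h | h | h
      · rw [hk y (hE' h), hE _ _ h, if_neg (hnot (hym_iff (hE' h))), sub_zero]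
      · have h1 := hE _ _ h
        rw [if_neg (hnot hxs), sub_zero] at h1
        rw [h1]
        by_cases hym : y = s m
        · subst hym
          have : ¬ ∃ z, N (s m) z := by
            rintro ⟨z, hz⟩
            rcases D.end_corner with h0 | h0
            · exact h0 _ h
            · exact h0 _ hz
          simp [k, this]
        · exact (hk y hym).symm
      · rw [hk y (hN' h), hN _ _ h, if_neg (hnot hxs), add_zero]
      · have h1 := hN _ _ h
        rw [h1]
        by_cases hym : y = s m
        · subst hym
          have h2 : ∃ z, N (s m) z := ⟨x, h⟩
          have h3 : ∃ j ≤ m, s m = s j := ⟨m, le_rfl, rfl⟩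
          simp only [k, h2, h3, and_self]
        · rw [hk y hym, if_neg (hnot (hym_iff hym)), add_zero]
    · rw [gridMatrix_of_not_adj hxy, gridMatrix_of_not_adj fun h => hxy (key'.mp h)]
      simp

/-- Removal of a good diagonal. -/
theorem factorsOn (D : IsGoodDiagonal E N m s t u) (G : IsExactGrid E N)
    (B : IsBipartition E N P Q) (hs : s 0 ∈ Q)
    (ih : ∀ (E' N' : S → S → Prop) (P' Q' : Finset S), IsExactGrid E' N' →
      IsBipartition E' N' P' Q' → P'.card + Q'.card < P.card + Q.card →
      FactorsOn (gridMatrix E' N') P' Q') :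
    FactorsOn (gridMatrix E N) P Q := by
  classical
  rcases Nat.eq_zero_or_pos m with rfl | hm
  · exact G.factorsOn_of_leaf B hs D.not_west D.not_south D.end_corner ih
  · obtain ⟨ε, hε, hsign⟩ := D.exists_sign G B hs
    refine D.factorsOn_of_eliminated G B hs le_rfl (FactorsOn.congr (FactorsOn.scale
      (ih _ _ _ _ (D.isExactGrid_zip G) (D.isBipartition_zip G B hs) ?_) ε hε) hsign)
    refine add_lt_add_of_le_of_lt (Finset.card_filter_le _ _) (Finset.card_lt_card ?_)
    rw [Finset.filter_ssubset]
    exact ⟨s 0, hs, fun h => h 0 hm rfl⟩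

end IsGoodDiagonal

/-! ### The induction -/

/-- The adjacency matrix of an exact grid factors. -/
theorem IsExactGrid.factorsOn {S : Type*} [Fintype S] {E N : S → S → Prop} {P Q : Finset S}
    (G : IsExactGrid E N) (B : IsBipartition E N P Q) : FactorsOn (gridMatrix E N) P Q := by
  classical
  induction hn : P.card + Q.card using Nat.strong_induction_on generalizing E N P Q with
  | _ n ih =>
  subst hn
  replace ih : ∀ (E' N' : S → S → Prop) (P' Q' : Finset S), IsExactGrid E' N' →
      IsBipartition E' N' P' Q' → P'.card + Q'.card < P.card + Q.card →
      FactorsOn (gridMatrix E' N') P' Q' := fun E' N' P' Q' G' B' h => ih _ h G' B' rfl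
  have ih' : ∀ (E' N' : S → S → Prop) (P' Q' : Finset S), IsExactGrid E' N' →
      IsBipartition E' N' P' Q' → P'.card + Q'.card < Q.card + P.card →
      FactorsOn (gridMatrix E' N') P' Q' :=
    fun E' N' P' Q' G' B' h => ih E' N' P' Q' G' B' (by omega)
  have of_corner : ∀ {E N : S → S → Prop}, IsExactGrid E N → IsBipartition E N P Q →
      (∃ a b, a ∈ P ∪ Q ∧ (∀ t, ¬ E t a) ∧ (∀ t, ¬ N t a) ∧
        Relation.ReflTransGen (IsExactGrid.Diag E N) a b ∧ ((∀ t, ¬ E b t) ∨ ∀ t, ¬ N b t)) →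
      FactorsOn (gridMatrix E N) P Q := by
    rintro E N G B ⟨a, b, ha, hw, hso, hab, hend⟩
    obtain ⟨m, s, rfl, rfl, hchain⟩ := hab.exists_chain
    have : Nonempty S := ⟨s 0⟩
    choose! u t hb using hchain
    have D : IsGoodDiagonal E N m s t u := ⟨hb, hw, hso, hend⟩
    rcases Finset.mem_union.mp ha with ha | ha
    · exact (D.factorsOn G B.swap ha ih').transpose.congr fun x _ y _ => gridMatrix_comm x y
    · exact D.factorsOn G B ha ih
  rcases (P ∪ Q).eq_empty_or_nonempty with h0 | hne
  · rw [Finset.union_eq_empty] at h0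
    obtain ⟨rfl, rfl⟩ := h0
    exact FactorsOn.empty
  have hE : ∀ a b, E a b → a ∈ P ∪ Q ∧ b ∈ P ∪ Q := fun a b h => by
    have := B.east a b h
    simp only [Finset.mem_union]
    tauto
  have hN : ∀ a b, N a b → a ∈ P ∪ Q ∧ b ∈ P ∪ Q := fun a b h => by
    have := B.north a b h
    simp only [Finset.mem_union]
    tauto
  have c1 := G.card_reflex_lt_card_convex hne hE hN
  have c2 := G.flip_both.card_reflex_lt_card_convex hne (fun a b h => (hE b a h).symm)
    (fun a b h => (hN b a h).symm)
  -- Either the north-eastern reflex corners are fewer than the south-western convex ones, or `c2`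
  -- and `c1` enclose this comparison and give the same inequality with all directions reversed.
  rcases lt_or_ge ({s | s ∈ P ∪ Q ∧ (∃ t, E s t) ∧ (∃ t, N s t) ∧
      ¬ ∃ t x y, IsBlock E N s t x y}.ncard)
      ({s | s ∈ P ∪ Q ∧ (∀ t, ¬ E t s) ∧ ∀ t, ¬ N t s}.ncard) with hcard | hcard
  · exact of_corner G B (G.exists_good_diagonal hE hcard)
  · exact (of_corner G.flip_both B.flip (G.flip_both.exists_good_diagonal
      (fun a b h => (hE b a h).symm) ((c2.trans_le hcard).trans c1))).congr
        fun x _ y _ => (gridMatrix_flip x y).symm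

/-! ### Rotation around vertices -/

namespace SquareGluing

variable {S : Type*} (G : SquareGluing S)

/-- The passage from a corner `d` across the side `d` to the next corner at the same vertex. -/
def rotate : Equiv.Perm (S × Fin 4) where
  toFun d := ((G.mate d).1, (G.mate d).2 + 1)
  invFun d := G.mate (d.1, d.2 - 1)
  left_inv d := by simp [G.mate_mate]
  right_inv d := by simp [G.mate_mate]

theorem vertex_rotate {d : S × Fin 4} (hd : G.mate d ≠ d) :
    (Quot.mk _ (G.rotate d) : G.Vertex) = Quot.mk _ d :=
  (Quot.sound (CornerRel.glue d hd)).symm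

theorem rotate_of_mate_eq {d : S × Fin 4} (hd : G.mate d = d) : G.rotate d = (d.1, d.2 + 1) := by
  change ((G.mate d).1, (G.mate d).2 + 1) = _
  rw [hd]

theorem rotate_mate (d : S × Fin 4) : G.rotate (G.mate d) = (d.1, d.2 + 1) := by
  change ((G.mate (G.mate d)).1, (G.mate (G.mate d)).2 + 1) = _
  rw [G.mate_mate]

/-- All sides met by rotation around the corner `d` are glued. -/
def IsInteriorCorner (d : S × Fin 4) : Prop := ∀ n : ℕ, G.mate (G.rotate^[n] d) ≠ G.rotate^[n] d

theorem IsInteriorCorner.rotate_iterate {G : SquareGluing S} {d : S × Fin 4}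
    (hd : G.IsInteriorCorner d) (n : ℕ) : G.IsInteriorCorner (G.rotate^[n] d) := by
  intro k
  rw [← Function.iterate_add_apply]
  exact hd _

theorem IsInteriorCorner.vertex_iterate {G : SquareGluing S} {d : S × Fin 4}
    (hd : G.IsInteriorCorner d) (n : ℕ) :
    (Quot.mk _ (G.rotate^[n] d) : G.Vertex) = Quot.mk _ d := by
  induction n with
  | zero => rfl
  | succ n ih => rw [Function.iterate_succ_apply', G.vertex_rotate (hd n), ih]

/-- All corners at a vertex are obtained from any of them by rotation. -/
theorem exists_iterate [Finite S] {G : SquareGluing S} {d e : S × Fin 4}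
    (h : (Quot.mk _ e : G.Vertex) = Quot.mk _ d) : ∃ n : ℕ, G.rotate^[n] d = e := by
  obtain ⟨k, hk, hper⟩ : d ∈ Function.periodicPts G.rotate :=
    G.rotate.injective.mem_periodicPts d
  have hrel : ∀ x y, G.CornerRel x y →
      (∃ n : ℕ, G.rotate^[n] d = x) = ∃ n : ℕ, G.rotate^[n] d = y := by
    rintro x _ ⟨⟩
    refine propext ⟨?_, ?_⟩
    · rintro ⟨n, rfl⟩
      exact ⟨n + 1, Function.iterate_succ_apply' _ _ _⟩
    · rintro ⟨n, hn⟩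
      have hn' : G.rotate^[n] d = G.rotate x := hn
      cases n with
      | succ n =>
        rw [Function.iterate_succ_apply'] at hn'
        exact ⟨n, G.rotate.injective hn'⟩
      | zero =>
        refine ⟨k - 1, G.rotate.injective ?_⟩
        rw [← hn', ← Function.iterate_succ_apply' G.rotate, Nat.succ_eq_add_one,
          Nat.sub_add_cancel hk]
        exact hper
  have := congrArg (Quot.lift (fun x => ∃ n : ℕ, G.rotate^[n] d = x) hrel) h
  change (∃ n : ℕ, G.rotate^[n] d = e) = (∃ n : ℕ, G.rotate^[n] d = d) at this
  rw [this]
  exact ⟨0, rfl⟩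

/-- The corners at both ends of an unglued side are consecutive under `rotate`, so a rotation cycle
through either end meets that side. -/
theorem IsInteriorCorner.isInterior [Finite S] {G : SquareGluing S} {d : S × Fin 4}
    (hd : G.IsInteriorCorner d) : G.IsInterior (Quot.mk _ d) := by
  intro s k hk
  refine ⟨fun h => ?_, fun h => ?_⟩
  · obtain ⟨n, hn⟩ := exists_iterate h.symm
    exact hd n (hn ▸ hk)
  · obtain ⟨n, hn⟩ := exists_iterate h.symm
    rw [← G.rotate_of_mate_eq hk] at hn
    cases n with
    | succ n =>
      rw [Function.iterate_succ_apply'] at hn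
      exact hd n (G.rotate.injective hn ▸ hk)
    | zero =>
      obtain ⟨j, hj, hper⟩ : d ∈ Function.periodicPts G.rotate :=
        G.rotate.injective.mem_periodicPts d
      have h1 : G.rotate (G.rotate^[j - 1] d) = G.rotate (s, k) := by
        rw [← hn, ← Function.iterate_succ_apply' G.rotate, Nat.succ_eq_add_one,
          Nat.sub_add_cancel hj]
        exact hper
      exact hd (j - 1) (G.rotate.injective h1 ▸ hk)

end SquareGluing

namespace QuadriculatedDisk

open SquareGluing

variable {S : Type*} (Δ : QuadriculatedDisk S)

/-- A square meets a vertex in only one corner, so the rotation cycle is in bijection with the four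
squares at the vertex. -/
theorem minimalPeriod_rotate [Finite S] {d : S × Fin 4} (hd : Δ.IsInteriorCorner d) :
    Function.minimalPeriod Δ.rotate d = 4 := by
  have h4 := Δ.interior_four _ hd.isInterior
  set p := Function.minimalPeriod Δ.rotate d
  have hsq : Δ.squaresAt (Quot.mk _ d) = (fun n : ℕ => (Δ.rotate^[n] d).1) '' Set.Iio p := by
    ext s
    constructor
    · rintro ⟨k, hk⟩
      obtain ⟨n, hn⟩ := exists_iterate hk
      refine ⟨n % p, Nat.mod_lt _ (Function.minimalPeriod_pos_of_mem_periodicPts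
        (Δ.rotate.injective.mem_periodicPts d)), ?_⟩
      simp only [p]
      rw [Function.iterate_mod_minimalPeriod_eq, hn]
    · rintro ⟨n, -, rfl⟩
      exact ⟨(Δ.rotate^[n] d).2, hd.vertex_iterate n⟩
  have hinj : Set.InjOn (fun n : ℕ => (Δ.rotate^[n] d).1) (Set.Iio p) := by
    intro a ha b hb hab
    refine Function.iterate_injOn_Iio_minimalPeriod ha hb (Prod.ext hab ?_)
    refine Δ.vertex_injective (Δ.rotate^[a] d).1 ?_
    refine (hd.vertex_iterate a).trans ((hd.vertex_iterate b).symm.trans ?_)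
    simp only at hab
    rw [hab]
    rfl
  rw [hsq, hinj.ncard_image] at h4
  simpa using h4

theorem rotate_four [Finite S] {d : S × Fin 4} (hd : Δ.IsInteriorCorner d) :
    Δ.rotate^[4] d = d := by
  have := Function.isPeriodicPt_minimalPeriod Δ.rotate d
  rwa [Δ.minimalPeriod_rotate hd] at this

variable {A : Type*} [AddCommGroup A]

theorem sum_range_congr [Finite S] (g : S × Fin 4 → A)
    (hsum : ∀ d, Δ.IsInteriorCorner d → ∑ i ∈ Finset.range 4, g (Δ.rotate^[i] d) = 0)
    {d : S × Fin 4} (hd : Δ.IsInteriorCorner d) {a b : ℕ} (hab : Δ.rotate^[a] d = Δ.rotate^[b] d) :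
    ∑ i ∈ Finset.range a, g (Δ.rotate^[i] d) = ∑ i ∈ Finset.range b, g (Δ.rotate^[i] d) := by
  have hadd : ∀ q r : ℕ, ∑ i ∈ Finset.range (r + 4 * q), g (Δ.rotate^[i] d) =
      ∑ i ∈ Finset.range r, g (Δ.rotate^[i] d) := by
    intro q r
    induction q with
    | zero => rfl
    | succ q ih =>
      rw [show r + 4 * (q + 1) = (r + 4 * q) + 4 by ring, Finset.sum_range_add, ih]
      have := hsum _ (hd.rotate_iterate (r + 4 * q))
      simp only [← Function.iterate_add_apply] at this
      rw [add_eq_left, ← this]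
      exact Finset.sum_congr rfl fun i _ => by rw [add_comm]
  have hmod : a % 4 = b % 4 := by
    have h := Function.iterate_injOn_Iio_minimalPeriod (f := Δ.rotate) (x := d)
    rw [Δ.minimalPeriod_rotate hd] at h
    refine h (Nat.mod_lt _ (by norm_num)) (Nat.mod_lt _ (by norm_num)) ?_
    have h2 := fun n => Function.iterate_mod_minimalPeriod_eq (f := Δ.rotate) (x := d) (n := n)
    simp only [Δ.minimalPeriod_rotate hd] at h2
    simp only [h2, hab]
  rw [← Nat.mod_add_div a 4, ← Nat.mod_add_div b 4, hadd, hadd, hmod]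

open Classical in
/-- A cochain on sides that is closed around interior vertices is exact near every vertex. -/
theorem exists_corner_potential [Finite S] (g : S × Fin 4 → A)
    (hsum : ∀ d, Δ.IsInteriorCorner d → ∑ i ∈ Finset.range 4, g (Δ.rotate^[i] d) = 0) :
    ∃ l : S × Fin 4 → A, ∀ d, Δ.mate d ≠ d → l (Δ.rotate d) = l d + g d := by
  have hint : ∀ d, Δ.mate d ≠ d → (Δ.IsInteriorCorner (Δ.rotate d) ↔ Δ.IsInteriorCorner d) := by
    intro d hd
    constructor
    · rintro h (_ | n)
      · exact hd
      · exact h n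
    · exact fun h => h.rotate_iterate 1
  have h₁ : ∃ l : S × Fin 4 → A, ∀ d, Δ.IsInteriorCorner d → l (Δ.rotate d) = l d + g d := by
    -- At an interior vertex, sum `g` along the rotation from a chosen corner; full turns contribute
    -- zero.
    let r : S × Fin 4 → S × Fin 4 := fun d => Quot.out (Quot.mk _ d : Δ.Vertex)
    have hr : ∀ d, Δ.IsInteriorCorner d → ∃ n : ℕ, Δ.rotate^[n] (r d) = d ∧
        Δ.IsInteriorCorner (r d) := by
      intro d hd
      obtain ⟨n, hn⟩ := exists_iterate (Quot.out_eq (Quot.mk _ d : Δ.Vertex))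
      have hrd : Δ.IsInteriorCorner (r d) := by
        change Δ.IsInteriorCorner (Quot.out (Quot.mk _ d : Δ.Vertex))
        rw [← hn]
        exact hd.rotate_iterate n
      obtain ⟨k, hk⟩ := exists_iterate (Quot.out_eq (Quot.mk _ d : Δ.Vertex)).symm
      exact ⟨k, hk, hrd⟩
    choose! k hk hrd using hr
    refine ⟨fun d => ∑ i ∈ Finset.range (k d), g (Δ.rotate^[i] (r d)), fun d hd => ?_⟩
    have hrr : r (Δ.rotate d) = r d := by
      change Quot.out (Quot.mk _ (Δ.rotate d) : Δ.Vertex) = _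
      rw [Δ.vertex_rotate (d := d) (hd 0)]
    have hd' : Δ.IsInteriorCorner (Δ.rotate d) := hd.rotate_iterate 1
    have e := Δ.sum_range_congr g hsum (hrd d hd) (a := k (Δ.rotate d)) (b := k d + 1) (by
      rw [Function.iterate_succ_apply', hk d hd, ← hrr, hk _ hd'])
    simp only [hrr]
    rw [e, Finset.sum_range_succ, hk d hd]
  have h₂ : ∃ l : S × Fin 4 → A, ∀ d, ¬ Δ.IsInteriorCorner d → Δ.mate d ≠ d →
      l (Δ.rotate d) = l d + g d := by
    have hex : ∀ d, ¬ Δ.IsInteriorCorner d → ∃ n : ℕ, Δ.mate (Δ.rotate^[n] d) = Δ.rotate^[n] d := by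
      intro d hd
      unfold SquareGluing.IsInteriorCorner at hd
      push Not at hd
      exact hd
    -- At a boundary vertex, normalize the potential to `0` at the corner where rotation first meets
    -- an unglued side, and sum back from there.
    refine ⟨fun d => if h : ∃ n : ℕ, Δ.mate (Δ.rotate^[n] d) = Δ.rotate^[n] d then
      - ∑ i ∈ Finset.range (Nat.find h), g (Δ.rotate^[i] d) else 0, fun d hd hm => ?_⟩
    have e1 := hex d hd
    have e2 := hex (Δ.rotate d) (fun h => hd ((hint d hm).mp h))
    simp only [dif_pos e1, dif_pos e2]
    have hfind : Nat.find e1 = Nat.find e2 + 1 := by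
      rw [Nat.find_eq_iff]
      refine ⟨Nat.find_spec e2, ?_⟩
      rintro (_ | n) hn
      · exact hm
      · exact Nat.find_min e2 (by omega)
    rw [hfind, Finset.sum_range_succ']
    simp only [Function.iterate_succ_apply, Function.iterate_zero, id]
    abel
  obtain ⟨l₁, h₁⟩ := h₁
  obtain ⟨l₂, h₂⟩ := h₂
  refine ⟨fun d => if Δ.IsInteriorCorner d then l₁ d else l₂ d, fun d hd => ?_⟩
  simp only [hint d hd]
  split_ifs with h
  · exact h₁ d h
  · exact h₂ d h hd

end QuadriculatedDisk

/-! ### From local to global potentials -/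

/-- The open star of a corner of the model square: the complement of the sides that do not
contain it. -/
def cornerStar : Fin 4 → Set (I × I)
  | 0 => {p | p.1 ≠ 1 ∧ p.2 ≠ 1}
  | 1 => {p | p.1 ≠ 0 ∧ p.2 ≠ 1}
  | 2 => {p | p.1 ≠ 0 ∧ p.2 ≠ 0}
  | 3 => {p | p.1 ≠ 1 ∧ p.2 ≠ 0}

theorem isOpen_cornerStar (k : Fin 4) : IsOpen (cornerStar k) := by
  have h1 : ∀ a : I, IsOpen {p : I × I | p.1 ≠ a} := fun a =>
    isOpen_ne.preimage continuous_fst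
  have h2 : ∀ a : I, IsOpen {p : I × I | p.2 ≠ a} := fun a =>
    isOpen_ne.preimage continuous_snd
  fin_cases k
  · exact (h1 1).inter (h2 1)
  · exact (h1 0).inter (h2 1)
  · exact (h1 0).inter (h2 0)
  · exact (h1 1).inter (h2 0)

theorem exists_mem_cornerStar (p : I × I) : ∃ k, p ∈ cornerStar k := by
  by_cases h1 : p.1 = 0 <;> by_cases h2 : p.2 = 0
  · exact ⟨0, by simp [cornerStar, h1, h2]⟩
  · exact ⟨3, by simp [cornerStar, h1, h2]⟩
  · exact ⟨1, by simp [cornerStar, h1, h2]⟩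
  · exact ⟨2, by simp [cornerStar, h1, h2]⟩

theorem sidePoint_mem_cornerStar (k j : Fin 4) (t : I) :
    sidePoint k t ∈ cornerStar j ↔ j = k ∧ t ≠ 1 ∨ j = k + 1 ∧ t ≠ 0 := by
  fin_cases k <;> fin_cases j <;> simp [sidePoint, cornerStar, unitInterval.symm_eq_zero,
    unitInterval.symm_eq_one]

namespace SquareGluing

variable {S : Type*} (G : SquareGluing S)

theorem vertex_mate {d : S × Fin 4} (hd : G.mate d ≠ d) :
    G.vertex (G.mate d).1 ((G.mate d).2 + 1) = G.vertex d.1 d.2 :=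
  G.vertex_rotate hd

theorem mate_mate_ne {d : S × Fin 4} (hd : G.mate d ≠ d) : G.mate (G.mate d) ≠ G.mate d := by
  rw [G.mate_mate]
  exact hd.symm

theorem vertex_mate' {d : S × Fin 4} (hd : G.mate d ≠ d) :
    G.vertex (G.mate d).1 (G.mate d).2 = G.vertex d.1 (d.2 + 1) := by
  have := G.vertex_mate (G.mate_mate_ne hd)
  rw [G.mate_mate] at this
  exact this.symm

theorem mem_star_sidePoint (v : G.Vertex) (s : S) (k : Fin 4) (t : I) :
    (∃ j, G.vertex s j = v ∧ sidePoint k t ∈ cornerStar j) ↔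
      G.vertex s k = v ∧ t ≠ 1 ∨ G.vertex s (k + 1) = v ∧ t ≠ 0 := by
  simp only [sidePoint_mem_cornerStar]
  constructor
  · rintro ⟨j, hj, ⟨rfl, ht⟩ | ⟨rfl, ht⟩⟩
    · exact Or.inl ⟨hj, ht⟩
    · exact Or.inr ⟨hj, ht⟩
  · rintro (⟨hj, ht⟩ | ⟨hj, ht⟩)
    · exact ⟨k, hj, Or.inl ⟨rfl, ht⟩⟩
    · exact ⟨k + 1, hj, Or.inr ⟨rfl, ht⟩⟩

/-- The open star of a vertex. -/
def star (v : G.Vertex) : Set G.Realization :=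
  {x | Quot.lift (fun q : Σ _ : S, I × I => ∃ k, G.vertex q.1 k = v ∧ q.2 ∈ cornerStar k)
    (by
      rintro _ _ ⟨d, hd, t⟩
      simp only [mem_star_sidePoint]
      rw [G.vertex_mate hd, G.vertex_mate' hd, ne_eq (unitInterval.symm t),
        ne_eq (unitInterval.symm t), unitInterval.symm_eq_one, unitInterval.symm_eq_zero, or_comm])
    x}

theorem mk_mem_star {v : G.Vertex} {s : S} {p : I × I} :
    (Quot.mk _ ⟨s, p⟩ : G.Realization) ∈ G.star v ↔ ∃ k, G.vertex s k = v ∧ p ∈ cornerStar k :=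
  Iff.rfl

theorem isOpen_realization_iff (W : Set G.Realization) :
    IsOpen W ↔ ∀ s, IsOpen {p : I × I | (Quot.mk _ ⟨s, p⟩ : G.Realization) ∈ W} := by
  rw [← isQuotientMap_quot_mk.isOpen_preimage, isOpen_sigma_iff]
  rfl

theorem isOpen_star (v : G.Vertex) : IsOpen (G.star v) := by
  rw [isOpen_realization_iff]
  intro s
  simp only [mk_mem_star]
  have : {p : I × I | ∃ k, G.vertex s k = v ∧ p ∈ cornerStar k} =
      ⋃ k, ⋃ (_ : G.vertex s k = v), cornerStar k := by
    ext p
    simp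
  rw [this]
  exact isOpen_iUnion fun k => isOpen_iUnion fun _ => isOpen_cornerStar k

end SquareGluing

namespace QuadriculatedDisk

variable {S : Type*} (Δ : QuadriculatedDisk S) {A : Type*} [AddCommGroup A]

instance : ContractibleSpace Δ.Realization := by
  obtain ⟨e⟩ := Δ.isDisk
  have : ContractibleSpace (Metric.closedBall (0 : EuclideanSpace ℝ (Fin 2)) 1) :=
    Metric.contractibleSpace_closedBall zero_le_one
  exact e.contractibleSpace

open Classical in
/-- A cochain on sides that is closed around interior vertices is exact. -/
theorem exists_potential [Finite S] (g : S × Fin 4 → A)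
    (hg : ∀ d, Δ.mate d ≠ d → g (Δ.mate d) = - g d)
    (hsum : ∀ d, Δ.IsInteriorCorner d → ∑ i ∈ Finset.range 4, g (Δ.rotate^[i] d) = 0) :
    ∃ h : S → A, ∀ d, Δ.mate d ≠ d → h (Δ.mate d).1 = h d.1 + g d := by
  obtain ⟨l, hl⟩ := Δ.exists_corner_potential g hsum
  -- `val v` is the local potential on the star of `v`. Two of them change by the same amount `g d`
  -- across a side, so their differences define a locally constant cocycle on the realization.
  let val : Δ.Vertex → S → A := fun v s =>
    if h : ∃ k, Δ.vertex s k = v then l (s, h.choose) else 0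
  have hval : ∀ s k, val (Δ.vertex s k) s = l (s, k) := by
    intro s k
    have h : ∃ j, Δ.vertex s j = Δ.vertex s k := ⟨k, rfl⟩
    simp only [val, dif_pos h]
    rw [Δ.vertex_injective s h.choose_spec]
  have hval_mate : ∀ d, Δ.mate d ≠ d → ∀ v t,
      (Quot.mk _ ⟨d.1, sidePoint d.2 t⟩ : Δ.Realization) ∈ Δ.star v →
      val v (Δ.mate d).1 = val v d.1 + g d := by
    intro d hd v t hv
    rw [SquareGluing.mk_mem_star, SquareGluing.mem_star_sidePoint] at hv
    rcases hv with ⟨rfl, -⟩ | ⟨rfl, -⟩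
    · rw [hval, ← Δ.vertex_mate hd, hval]
      exact hl d hd
    · rw [hval, ← Δ.vertex_mate' hd, hval]
      have := hl _ (Δ.mate_mate_ne hd)
      rw [Δ.rotate_mate, hg d hd] at this
      rw [this]
      exact (neg_add_cancel_right _ _).symm
  let T₀ : Δ.Vertex → Δ.Vertex → (Σ _ : S, I × I) → A := fun v w q =>
    if (Quot.mk _ q : Δ.Realization) ∈ Δ.star v ∧ (Quot.mk _ q : Δ.Realization) ∈ Δ.star w then
      val w q.1 - val v q.1 else 0
  let T : Δ.Vertex → Δ.Vertex → Δ.Realization → A := fun v w => Quot.lift (T₀ v w) (by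
    rintro _ _ ⟨d, hd, t⟩
    simp only [T₀]
    rw [← Quot.sound (SquareGluing.PointRel.glue d hd t)]
    split_ifs with h
    · rw [hval_mate d hd v t h.1, hval_mate d hd w t h.2]
      abel
    · rfl)
  have hT : ∀ v w s p, (Quot.mk _ ⟨s, p⟩ : Δ.Realization) ∈ Δ.star v →
      (Quot.mk _ ⟨s, p⟩ : Δ.Realization) ∈ Δ.star w →
      T v w (Quot.mk _ ⟨s, p⟩) = val w s - val v s := by
    intro v w s p h1 h2
    exact if_pos ⟨h1, h2⟩
  have hcov : ∀ x, ∃ v, x ∈ Δ.star v := by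
    rintro ⟨s, p⟩
    obtain ⟨k, hk⟩ := exists_mem_cornerStar p
    exact ⟨Δ.vertex s k, k, rfl, hk⟩
  obtain ⟨φ, hφ, hφT⟩ := exists_primitive_of_locally_constant_cocycle Δ.star Δ.isOpen_star hcov T
    (by
      intro v w x hx
      have hopen : IsOpen {y | y ∈ Δ.star v ∧ y ∈ Δ.star w ∧ T v w y = T v w x} := by
        rw [SquareGluing.isOpen_realization_iff]
        intro s
        have h1 := (Δ.isOpen_realization_iff _).mp (Δ.isOpen_star v) s
        have h2 := (Δ.isOpen_realization_iff _).mp (Δ.isOpen_star w) s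
        have h3 : IsOpen {p : I × I | val w s - val v s = T v w x} := isOpen_const
        convert (h1.inter h2).inter h3 using 1
        ext p
        constructor
        · rintro ⟨a, b, c⟩
          exact ⟨⟨a, b⟩, (hT v w s p a b).symm.trans c⟩
        · rintro ⟨⟨a, b⟩, c⟩
          exact ⟨a, b, (hT v w s p a b).trans c⟩
      exact Filter.mem_of_superset (hopen.mem_nhds ⟨hx.1, hx.2, rfl⟩) fun y hy => hy.2.2)
    (by
      rintro v w z ⟨s, p⟩ h1 h2 h3
      rw [hT v w s p h1 h2, hT w z s p h2 h3, hT v z s p h1 h3]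
      abel)
  have hchart : ∀ s p j k, p ∈ cornerStar j → p ∈ cornerStar k →
      φ (Δ.vertex s j) (Quot.mk _ ⟨s, p⟩) - l (s, j) =
        φ (Δ.vertex s k) (Quot.mk _ ⟨s, p⟩) - l (s, k) := by
    intro s p j k hj hk
    rw [hφT (Δ.vertex s j) (Δ.vertex s k) (Quot.mk _ ⟨s, p⟩) ⟨j, rfl, hj⟩ ⟨k, rfl, hk⟩,
      hT _ _ _ _ ⟨j, rfl, hj⟩ ⟨k, rfl, hk⟩, hval, hval]
    abel
  choose κ hκ using exists_mem_cornerStar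
  -- The difference between the primitive and the local potential does not depend on the vertex and
  -- is locally constant on the connected square `s`. Its negative is the global potential.
  let F : S → I × I → A := fun s p => φ (Δ.vertex s (κ p)) (Quot.mk _ ⟨s, p⟩) - l (s, κ p)
  have hF : ∀ s p q, F s p = F s q := by
    intro s
    have hlc : IsLocallyConstant (F s) := by
      rw [IsLocallyConstant.iff_eventually_eq]
      intro p
      have hcont : Continuous fun p : I × I => (Quot.mk _ ⟨s, p⟩ : Δ.Realization) :=
        continuous_quot_mk.comp continuous_sigmaMk
      have h1 := hcont.continuousAt.eventually
        (hφ (Δ.vertex s (κ p)) (Quot.mk _ ⟨s, p⟩) ⟨κ p, rfl, hκ p⟩)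
      have h2 := (isOpen_cornerStar (κ p)).mem_nhds (hκ p)
      filter_upwards [h1, h2] with q hq hq'
      change φ _ _ - _ = φ _ _ - _
      rw [hchart s q (κ q) (κ p) (hκ q) hq', hq]
    exact fun p q => hlc.apply_eq_of_preconnectedSpace p q
  refine ⟨fun s => - F s (0, 0), fun d hd => ?_⟩
  have hp : sidePoint d.2 0 ∈ cornerStar d.2 := by
    rw [sidePoint_mem_cornerStar]
    simp
  have hp' : sidePoint (Δ.mate d).2 (unitInterval.symm 0) ∈ cornerStar ((Δ.mate d).2 + 1) := by
    rw [sidePoint_mem_cornerStar]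
    simp
  have e1 : F d.1 (0, 0) = φ (Δ.vertex d.1 d.2) (Quot.mk _ ⟨d.1, sidePoint d.2 0⟩) - l d :=
    (hF _ _ _).trans (hchart d.1 (sidePoint d.2 0) _ d.2 (hκ _) hp)
  have e2 : F (Δ.mate d).1 (0, 0) =
      φ (Δ.vertex d.1 d.2) (Quot.mk _ ⟨d.1, sidePoint d.2 0⟩) - (l d + g d) := by
    rw [hF _ _ (sidePoint (Δ.mate d).2 (unitInterval.symm 0)),
      Quot.sound (SquareGluing.PointRel.glue d hd 0), ← Δ.vertex_mate hd, ← hl d hd]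
    exact hchart _ _ _ _ (hκ _) hp'
  simp only [e1, e2]
  abel

end QuadriculatedDisk

/-! ### Orienting the squares of a disk -/

namespace QuadriculatedDisk

variable {S : Type*} (Δ : QuadriculatedDisk S)

/-- Different sides of a square are not glued to each other. -/
theorem mate_fst_ne {d : S × Fin 4} (hd : Δ.mate d ≠ d) : (Δ.mate d).1 ≠ d.1 := by
  intro h
  have h1 := Δ.vertex_mate hd
  have h2 := Δ.vertex_mate' hd
  rw [h] at h1 h2
  have e1 := Δ.vertex_injective _ h1
  have e2 := Δ.vertex_injective _ h2
  revert e1 e2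
  generalize (Δ.mate d).2 = a
  generalize d.2 = b
  revert a b
  decide

/-- Rotations `a` of the squares after which glued sides have opposite directions. -/
def IsOrientation (a : S → Fin 4) : Prop :=
  ∀ d, Δ.mate d ≠ d → (Δ.mate d).2 + a (Δ.mate d).1 = d.2 + a d.1 + 2

/-- Each step around a vertex contributes `3` in `Fin 4`, besides telescoping terms. Four steps give
`0`, so the potential exists; this is where the valence four is essential. -/
theorem exists_orientation [Finite S] : ∃ a : S → Fin 4, Δ.IsOrientation a := by
  obtain ⟨a, ha⟩ := Δ.exists_potential (A := Fin 4) (fun d => d.2 - (Δ.mate d).2 + 2)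
    (by
      intro d _
      rw [Δ.mate_mate]
      generalize (Δ.mate d).2 = x
      generalize d.2 = y
      revert x y
      decide)
    (by
      intro d hd
      have hstep : ∀ e, (Δ.mate e).2 = (Δ.rotate e).2 - 1 := fun e =>
        (add_sub_cancel_right (Δ.mate e).2 1).symm
      have h4 : Δ.rotate (Δ.rotate (Δ.rotate (Δ.rotate d))) = d := Δ.rotate_four hd
      simp only [Finset.sum_range_succ, Finset.sum_range_zero, hstep, Function.iterate_succ_apply',
        Function.iterate_zero, id, h4]
      generalize d.2 = x
      generalize (Δ.rotate d).2 = y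
      generalize (Δ.rotate (Δ.rotate d)).2 = z
      generalize (Δ.rotate (Δ.rotate (Δ.rotate d))).2 = w
      revert x y z w
      decide)
  refine ⟨a, fun d hd => ?_⟩
  rw [ha d hd]
  generalize (Δ.mate d).2 = x
  generalize d.2 = y
  generalize a d.1 = z
  revert x y z
  decide

/-- The neighbor of `s` in the direction `k`, for squares rotated by `a`. -/
def Neighbor (a : S → Fin 4) (k : Fin 4) (s t : S) : Prop :=
  ∃ d, Δ.mate d ≠ d ∧ d.1 = s ∧ (Δ.mate d).1 = t ∧ d.2 + a d.1 = k

section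

variable {Δ} {a : S → Fin 4}

theorem neighbor_symm (ha : Δ.IsOrientation a) {k : Fin 4} {s t : S} (h : Δ.Neighbor a k s t) :
    Δ.Neighbor a (k + 2) t s := by
  obtain ⟨d, hd, rfl, rfl, rfl⟩ := h
  exact ⟨Δ.mate d, Δ.mate_mate_ne hd, rfl, by rw [Δ.mate_mate], ha d hd⟩

theorem neighbor_rightUnique {k : Fin 4} {s t t' : S} (h : Δ.Neighbor a k s t)
    (h' : Δ.Neighbor a k s t') : t = t' := by
  obtain ⟨d, -, rfl, rfl, hk⟩ := h
  obtain ⟨d', -, h1, rfl, hk'⟩ := h'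
  have : d' = d := Prod.ext h1 (by
    rw [h1] at hk'
    exact add_right_cancel (hk'.trans hk.symm))
  rw [this]

theorem neighbor_biUnique (ha : Δ.IsOrientation a) (k : Fin 4) :
    Relator.BiUnique (Δ.Neighbor a k) :=
  ⟨fun _ _ _ h h' => neighbor_rightUnique (neighbor_symm ha h) (neighbor_symm ha h'),
    fun _ _ _ h h' => neighbor_rightUnique h h'⟩

/-- Crossing a side adds `2` to the direction and passing to the next side adds `1`, so rotation
turns clockwise. -/
theorem direction_rotate (ha : Δ.IsOrientation a) {d : S × Fin 4} (hd : Δ.mate d ≠ d) :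
    (Δ.rotate d).2 + a (Δ.rotate d).1 = d.2 + a d.1 + 3 := by
  have h := ha d hd
  change (Δ.mate d).2 + 1 + a (Δ.mate d).1 = _
  rw [add_right_comm, h]
  generalize d.2 + a d.1 = x
  revert x
  decide

/-- The four squares around an interior vertex form a block. A cochain on eastward and northward
steps, extended by antisymmetry to all four directions, is therefore closed around interior vertices
when it is closed on blocks, and `exists_potential` applies. -/
theorem isExactGrid_neighbor (ha : Δ.IsOrientation a) [Finite S] :
    IsExactGrid (Δ.Neighbor a 0) (Δ.Neighbor a 1) where
  east := neighbor_biUnique ha 0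
  north := neighbor_biUnique ha 1
  exact A _ f g H := by
    let c : Fin 4 → S → S → A
      | 0, s, t => f s t
      | 1, s, t => g s t
      | 2, s, t => - f t s
      | 3, s, t => - g t s
    have hc : ∀ k s t, c (k + 2) t s = - c k s t := by
      intro k s t
      fin_cases k
      · rfl
      · rfl
      · exact (neg_neg _).symm
      · exact (neg_neg _).symm
    let C : S × Fin 4 → A := fun d => c (d.2 + a d.1) d.1 (Δ.mate d).1
    -- Direction `1` means that `d` is the north-eastern corner of the south-western square of the
    -- block. The other three starting corners are reduced to this one by rotation.
    have hsum₁ : ∀ d, Δ.IsInteriorCorner d → d.2 + a d.1 = 1 →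
        C d + C (Δ.rotate d) + C (Δ.rotate (Δ.rotate d)) +
          C (Δ.rotate (Δ.rotate (Δ.rotate d))) = 0 := by
      intro d hd h0
      have h4 : Δ.rotate (Δ.rotate (Δ.rotate (Δ.rotate d))) = d := Δ.rotate_four hd
      have m0 : Δ.mate d ≠ d := hd 0
      have m1 : Δ.mate (Δ.rotate d) ≠ Δ.rotate d := hd 1
      have m2 : Δ.mate (Δ.rotate (Δ.rotate d)) ≠ Δ.rotate (Δ.rotate d) := hd 2
      have m3 : Δ.mate (Δ.rotate (Δ.rotate (Δ.rotate d))) ≠ Δ.rotate (Δ.rotate (Δ.rotate d)) :=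
        hd 3
      have h1 : (Δ.rotate d).2 + a (Δ.rotate d).1 = 0 := by
        rw [direction_rotate ha m0, h0]
        rfl
      have h2 : (Δ.rotate (Δ.rotate d)).2 + a (Δ.rotate (Δ.rotate d)).1 = 3 := by
        rw [direction_rotate ha m1, h1]
        rfl
      have h3 : (Δ.rotate (Δ.rotate (Δ.rotate d))).2 + a (Δ.rotate (Δ.rotate (Δ.rotate d))).1 =
          2 := by
        rw [direction_rotate ha m2, h2]
        rfl
      have hmate : ∀ e, (Δ.mate e).1 = (Δ.rotate e).1 := fun _ => rfl
      have b1 : Δ.Neighbor a 0 d.1 (Δ.rotate (Δ.rotate (Δ.rotate d))).1 :=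
        neighbor_symm ha ⟨_, m3, rfl, by rw [hmate, h4], h3⟩
      have b2 : Δ.Neighbor a 1 (Δ.rotate (Δ.rotate (Δ.rotate d))).1 (Δ.rotate (Δ.rotate d)).1 :=
        neighbor_symm ha ⟨_, m2, rfl, rfl, h2⟩
      have b3 : Δ.Neighbor a 1 d.1 (Δ.rotate d).1 := ⟨_, m0, rfl, rfl, h0⟩
      have b4 : Δ.Neighbor a 0 (Δ.rotate d).1 (Δ.rotate (Δ.rotate d)).1 := ⟨_, m1, rfl, rfl, h1⟩
      have key := H _ _ _ _ ⟨b1, b2, b3, b4⟩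
      simp only [C, h0, h1, h2, h3, hmate, h4]
      change g d.1 (Δ.rotate d).1 + f (Δ.rotate d).1 (Δ.rotate (Δ.rotate d)).1 +
        - g (Δ.rotate (Δ.rotate (Δ.rotate d))).1 (Δ.rotate (Δ.rotate d)).1 +
        - f d.1 (Δ.rotate (Δ.rotate (Δ.rotate d))).1 = 0
      rw [← key]
      abel
    obtain ⟨h, hh⟩ := Δ.exists_potential C
      (by
        intro d hd
        simp only [C]
        rw [Δ.mate_mate, ha d hd, hc])
      (by
        intro d hd
        have h4 : Δ.rotate (Δ.rotate (Δ.rotate (Δ.rotate d))) = d := Δ.rotate_four hd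
        simp only [Finset.sum_range_succ, Finset.sum_range_zero, Function.iterate_succ_apply',
          Function.iterate_zero, id, zero_add]
        have r1 := direction_rotate ha (d := d) (hd 0)
        have r2 := direction_rotate ha (d := Δ.rotate d) (hd 1)
        have r3 := direction_rotate ha (d := Δ.rotate (Δ.rotate d)) (hd 2)
        obtain h0 | h0 | h0 | h0 : d.2 + a d.1 = 0 ∨ d.2 + a d.1 = 1 ∨ d.2 + a d.1 = 2 ∨
            d.2 + a d.1 = 3 := by
          generalize d.2 + a d.1 = x
          revert x
          decide
        · rw [h0] at r1
          rw [r1] at r2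
          rw [r2] at r3
          have := hsum₁ _ (hd.rotate_iterate 3) r3
          simp only [Function.iterate_succ_apply', Function.iterate_zero, id, h4] at this
          rw [← this]
          abel
        · exact hsum₁ d hd h0
        · rw [h0] at r1
          have := hsum₁ _ (hd.rotate_iterate 1) r1
          simp only [Function.iterate_succ_apply', Function.iterate_zero, id, h4] at this
          rw [← this]
          abel
        · rw [h0] at r1
          rw [r1] at r2
          have := hsum₁ _ (hd.rotate_iterate 2) r2
          simp only [Function.iterate_succ_apply', Function.iterate_zero, id, h4] at this
          rw [← this]
          abel)
    refine ⟨h, ?_, ?_⟩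
    · rintro _ _ ⟨d, hd, rfl, rfl, hk⟩
      rw [hh d hd, add_sub_cancel_left]
      simp only [C, hk]
      rfl
    · rintro _ _ ⟨d, hd, rfl, rfl, hk⟩
      rw [hh d hd, add_sub_cancel_left]
      simp only [C, hk]
      rfl

theorem adj_iff_gridAdj (ha : Δ.IsOrientation a) {s t : S} :
    Δ.Adj s t ↔ GridAdj (Δ.Neighbor a 0) (Δ.Neighbor a 1) s t := by
  have hadj : ∀ {k s t}, Δ.Neighbor a k s t → Δ.Adj s t := by
    rintro k _ _ ⟨d, hd, rfl, rfl, -⟩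
    exact ⟨(Δ.mate_fst_ne hd).symm, d.2, (Δ.mate d).2, rfl⟩
  have hsymm : ∀ {s t}, Δ.Adj s t → Δ.Adj t s := by
    rintro s t ⟨hne, k, l, h⟩
    exact ⟨hne.symm, l, k, by rw [← h, Δ.mate_mate]⟩
  constructor
  · rintro ⟨hne, k, l, h⟩
    have hd : Δ.mate (s, k) ≠ (s, k) := fun h' => hne (congrArg Prod.fst (h'.symm.trans h))
    have hn : Δ.Neighbor a (k + a s) s t := ⟨(s, k), hd, rfl, by rw [h], rfl⟩
    obtain h0 | h0 | h0 | h0 : k + a s = 0 ∨ k + a s = 1 ∨ k + a s = 2 ∨ k + a s = 3 := by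
      generalize k + a s = x
      revert x
      decide
    · exact Or.inl (h0 ▸ hn)
    · exact Or.inr (Or.inr (Or.inl (h0 ▸ hn)))
    · rw [h0] at hn
      exact Or.inr (Or.inl (neighbor_symm ha hn))
    · rw [h0] at hn
      exact Or.inr (Or.inr (Or.inr (neighbor_symm ha hn)))
  · rintro (h | h | h | h)
    · exact hadj h
    · exact hsymm (hadj h)
    · exact hadj h
    · exact hsymm (hadj h)

end

end QuadriculatedDisk

/-! ### The main theorem -/

theorem theorem1 {S : Type*} [Fintype S] (Δ : QuadriculatedDisk S) (hS : 2 ≤ Fintype.card S) :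
    (∃ c : S → Bool, Δ.IsBicoloring c) ∧
    ∀ c : S → Bool, Δ.IsBicoloring c →
      ∃ (b w : ℕ) (β : Fin b ≃ {s // c s = true}) (ω : Fin w ≃ {s // c s = false})
        (L : Matrix (Fin b) (Fin b) ℤ) (D : Matrix (Fin b) (Fin w) ℤ)
        (U : Matrix (Fin w) (Fin w) ℤ),
        Δ.blackToWhite β ω = L * D * U ∧
        L.IsLowerTriangular ∧ IsUnit L ∧
        U.IsUpperTriangular ∧ IsUnit U ∧
        IsDefectiveIdentity D ∧
        HasUnitEntries L ∧ HasUnitEntries D ∧ HasUnitEntries U := by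
  obtain ⟨a, ha⟩ := Δ.exists_orientation
  have G := QuadriculatedDisk.isExactGrid_neighbor ha
  refine ⟨?_, fun c hc => ?_⟩
  · obtain ⟨h, h0, h1⟩ := G.exact (ZMod 2) (fun _ _ => 1) (fun _ _ => 1) fun _ _ _ _ _ => rfl
    refine ⟨fun s => decide (h s = 0), fun s t hst heq => ?_⟩
    have hne : h s ≠ h t := by
      intro e
      rcases (QuadriculatedDisk.adj_iff_gridAdj ha).mp hst with h' | h' | h' | h'
      · have := h0 _ _ h'
        rw [e, sub_self] at this
        exact one_ne_zero this
      · have := h0 _ _ h'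
        rw [e, sub_self] at this
        exact one_ne_zero this
      · have := h1 _ _ h'
        rw [e, sub_self] at this
        exact one_ne_zero this
      · have := h1 _ _ h'
        rw [e, sub_self] at this
        exact one_ne_zero this
    rw [decide_eq_decide] at heq
    revert hne heq
    generalize h s = x
    generalize h t = y
    revert x y
    decide
  · have hcol : ∀ s t, GridAdj (Δ.Neighbor a 0) (Δ.Neighbor a 1) s t →
        s ∈ Finset.univ.filter (c · = true) ∧ t ∈ Finset.univ.filter (c · = false) ∨
        s ∈ Finset.univ.filter (c · = false) ∧ t ∈ Finset.univ.filter (c · = true) := by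
      intro s t hst
      have := hc s t ((QuadriculatedDisk.adj_iff_gridAdj ha).mpr hst)
      simp only [Finset.mem_filter, Finset.mem_univ, true_and]
      revert this
      generalize c s = x
      generalize c t = y
      revert x y
      decide
    have B : IsBipartition (Δ.Neighbor a 0) (Δ.Neighbor a 1) (Finset.univ.filter (c · = true))
        (Finset.univ.filter (c · = false)) :=
      ⟨fun x hx hx' => by simp_all, fun s t h => hcol s t (Or.inl h),
        fun s t h => hcol s t (Or.inr (Or.inr (Or.inl h)))⟩
    obtain ⟨b, w, β, ω, L, D, U, hβ, hP, hω, hQ, hLDU, hL, hL', hU, hU', hD, hLe, hUe⟩ :=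
      G.factorsOn B
    have hβc : ∀ i, c (β i) = true := fun i => by
      have : β i ∈ ((Finset.univ.filter (c · = true) : Finset S) : Set S) :=
        hP ▸ Set.mem_range_self i
      simpa using this
    have hωc : ∀ i, c (ω i) = false := fun i => by
      have : ω i ∈ ((Finset.univ.filter (c · = false) : Finset S) : Set S) :=
        hQ ▸ Set.mem_range_self i
      simpa using this
    refine ⟨b, w, Equiv.ofBijective (fun i => ⟨β i, hβc i⟩)
      ⟨fun i j h => hβ (congrArg Subtype.val h), fun ⟨s, hs⟩ => ?_⟩, Equiv.ofBijective (fun i => ⟨ω i, hωc i⟩)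
      ⟨fun i j h => hω (congrArg Subtype.val h), fun ⟨s, hs⟩ => ?_⟩, L, D, U, ?_, hL, hL', hU, hU',
      hD, hLe, hD.hasUnitEntries, hUe⟩
    · obtain ⟨i, hi⟩ : s ∈ Set.range β := by rw [hP]; simpa using hs
      exact ⟨i, Subtype.ext hi⟩
    · obtain ⟨i, hi⟩ : s ∈ Set.range ω := by rw [hQ]; simpa using hs
      exact ⟨i, Subtype.ext hi⟩
    · rw [← hLDU]
      ext i j
      simp only [SquareGluing.blackToWhite, Matrix.of_apply, gridMatrix]
      congr 1
      exact propext (QuadriculatedDisk.adj_iff_gridAdj ha)
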